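/- Let $d\ge 1$. A map $f:\mathrm{SU}(d)\to\mathrm{SU}(d)$ is implemented deterministically and exactly with $N$ queries if there are an auxiliary system $\mathcal H_A=\mathbb{C}^m$ (for some finite $m$), a fixed density matrix $\rho_A$ on $\mathcal H_A$ and fixed unitary operators $V_1,\dots,V_{N+1}$ on $\mathbb{C}^d\otimes\mathcal H_A$ such that, with $Z(U)=V_{N+1}(U\otimes I)V_N(U\otimes I)\cdots(U\otimes I)V_1$ ($N$ factors $U\otimes I$), $$\operatorname{tr}_{\mathcal H_A}\!\left[Z(U)(\rho\otimes\rho_A)Z(U)^\dagger\right]=f(U)\,\rho\, f(U)^\dagger$$ for every $U\in\mathrm{SU}(d)$ and every density matrix $\rho$ on $\mathbb{C}^d$. The query complexity of $f$ is the least such $N$, and $\infty$ if there is none. With transposition and complex conjugation taken in the computational basis: 1. if $d\ge 2$, the query complexity of unitary inversion $f(U)=U^{-1}$ is at least $d^2$; 2. the query complexity of unitary transposition $f(U)=U^{T}$ is at least $4$ if $d=2$, and at least $d+3$ if $d\ge 3$; 3. the query complexity of unitary complex conjugation $f(U)=U^{*}$ is at least $d-1$, and this bound is tight: it equals $d-1$.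 -/

import Mathlib

open scoped Kronecker ComplexOrder

namespace UnitaryQuery

/-- The special unitary group `SU(d)`, as matrices in the computational basis of `ℂ^d`. -/
abbrev SU (d : ℕ) : Type := Matrix.specialUnitaryGroup (Fin d) ℂ

/-- Unitary inversion `U ↦ U⁻¹` (the group inverse of `SU(d)`). -/
def inversion (d : ℕ) (U : SU d) : SU d := U⁻¹

theorem transpose_mem (d : ℕ) (U : SU d) :
    (U : Matrix (Fin d) (Fin d) ℂ).transpose ∈ Matrix.specialUnitaryGroup (Fin d) ℂ := by
  have h := Matrix.mem_specialUnitaryGroup_iff.1 U.2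
  have h1 := Matrix.mem_unitaryGroup_iff'.1 h.1
  refine Matrix.mem_specialUnitaryGroup_iff.2 ⟨Matrix.mem_unitaryGroup_iff.2 ?_, ?_⟩
  · have h2 := congrArg Matrix.transpose h1
    rw [Matrix.transpose_mul, Matrix.transpose_one] at h2
    exact h2
  · rw [Matrix.det_transpose]
    exact h.2

/-- Unitary transposition `U ↦ Uᵀ` in the computational basis. -/
def transposition (d : ℕ) (U : SU d) : SU d :=
  ⟨(U : Matrix (Fin d) (Fin d) ℂ).transpose, transpose_mem d U⟩

theorem conj_mem (d : ℕ) (U : SU d) :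
    (U : Matrix (Fin d) (Fin d) ℂ).map (starRingEnd ℂ) ∈
      Matrix.specialUnitaryGroup (Fin d) ℂ :=
  transpose_mem d U⁻¹

/-- Complex conjugation `U ↦ U^*`, entrywise in the computational basis. -/
def conjugation (d : ℕ) (U : SU d) : SU d :=
  ⟨(U : Matrix (Fin d) (Fin d) ℂ).map (starRingEnd ℂ), conj_mem d U⟩

/-- `ρ` is a density matrix (a quantum state): positive semidefinite of trace one. -/
def IsDensityMatrix {ι : Type} [Fintype ι] (ρ : Matrix ι ι ℂ) : Prop :=
  ρ.PosSemidef ∧ ρ.trace = 1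

/-- The partial trace over the second tensor factor. -/
def partialTrace {ι κ : Type} [Fintype κ] (M : Matrix (ι × κ) (ι × κ) ℂ) : Matrix ι ι ℂ :=
  Matrix.of fun i j => ∑ a, M (i, a) (j, a)

/-- The operator `V_{N+1} (U ⊗ I) V_N (U ⊗ I) ⋯ (U ⊗ I) V_1` on `ℂ^d ⊗ ℂ^m` of a fixed-order
circuit with `N` queries to `U`; the gate `V_{k+1}` is `V k`. -/
def circuit {d m : ℕ} : (N : ℕ) → (Fin (N + 1) → Matrix.unitaryGroup (Fin d × Fin m) ℂ) →
    SU d → Matrix (Fin d × Fin m) (Fin d × Fin m) ℂ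
  | 0, V, _ => (V 0 : Matrix (Fin d × Fin m) (Fin d × Fin m) ℂ)
  | N + 1, V, U =>
      (V (Fin.last (N + 1)) : Matrix (Fin d × Fin m) (Fin d × Fin m) ℂ) *
        ((U : Matrix (Fin d) (Fin d) ℂ) ⊗ₖ (1 : Matrix (Fin m) (Fin m) ℂ)) *
        circuit N (fun k => V k.castSucc) U

/-- `f` can be implemented deterministically and exactly with `N` queries: there are an auxiliary
system `ℂ^m` in a fixed state `ρA` and fixed unitary gates `V_1, …, V_{N+1}` on `ℂ^d ⊗ ℂ^m` such
that for every `U` the circuit, followed by discarding the auxiliary system, sends every state `ρ`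
to `f(U) ρ f(U)†`. -/
def Implementable {d : ℕ} (f : SU d → SU d) (N : ℕ) : Prop :=
  ∃ (m : ℕ) (ρA : Matrix (Fin m) (Fin m) ℂ)
    (V : Fin (N + 1) → Matrix.unitaryGroup (Fin d × Fin m) ℂ),
    IsDensityMatrix ρA ∧
    ∀ (U : SU d) (ρ : Matrix (Fin d) (Fin d) ℂ), IsDensityMatrix ρ →
      partialTrace (circuit N V U * (ρ ⊗ₖ ρA) * (circuit N V U).conjTranspose) =
        (f U : Matrix (Fin d) (Fin d) ℂ) * ρ * (f U : Matrix (Fin d) (Fin d) ℂ).conjTranspose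

/-- The query complexity of `f`: the minimum number of queries with which `f` can be implemented
deterministically and exactly, and `∞` if there is no such number. -/
noncomputable def queryComplexity {d : ℕ} (f : SU d → SU d) : ℕ∞ :=
  ⨅ (N : ℕ) (_ : Implementable f N), (N : ℕ∞)

end UnitaryQuery

/-! All lower bounds come from differentiating an exact circuit. After purifying the auxiliary
state, exactness says that every Kraus operator of the whole circuit is a multiple of `f U`
(`Implementable.exists_pure`). Let `K_{k,j}(U)` be the Kraus operators of the circuit just after its
first `k` queries and the gate that follows them. Along a curve `U₀ u(t)` in `SU(d)` with `u'(0) =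
iH`, let `i G(H)` be the derivative of `f(U₀)† f(U₀ u(t))`. The product rule gives `∑_{k<N} ∑_j
K_{k,j}† H K_{k,j} = G(H) + scalar`. The left side is a sum of `N` unital completely positive maps,
so the Choi matrix of `G`, corrected by some `β ⊗ 1`, is positive; here `tr β = N - γ` when `G(1) =
γ 1` (`exists_choi`). Each part tests this positivity on suitable vectors.

Inversion: `G(X) = -U₀ X U₀†`, and the maximally entangled vector gives `∑ |tr(K U₀)|² = N + 1 -
d²`. Equality to zero would make the operators `K_{0,j}`, which do not depend on `U`, orthogonal to
all of `SU(d)`, hence zero. Conjugation: `G(X) = -Xᵀ` at the identity, and the diagonal entries give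
`β_pp ≥ 1`, so `N + 1 ≥ d`.

Transposition: antisymmetric vectors show that the total asymmetry of the operators `K Ū` is
`2(d-1)(N-1-d)`. Averaged over a unitary 1-design, the terms with `k = 0` alone contribute `2(d-1)`,
so `N ≥ d + 2`. If `N = d + 2`, then `U K_{1,j}(U)` is symmetric for all `U`; since `K_{1,j}` is
linear in `U`, polarization for `d ≥ 3` forces `K_{1,j}(U) = n_j Uᵀ`
(`eq_mul_transpose_of_symmetric`), which would make transposition completely positive.

Tightness for conjugation: `U^{⊗(d-1)}` acts on the antisymmetric subspace as `U^*`, so encoding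
into that subspace, querying each register once and decoding suffices. -/

namespace UnitaryQuery

open Matrix

/-! ### Kraus operators of unitary channels -/

section KrausOperators

variable {n r : Type} [Fintype n] [DecidableEq n] [Fintype r]

omit [DecidableEq n] in
theorem isDensityMatrix_vecMulVec {v : n → ℂ} (hv : ∑ i, v i * star (v i) = 1) :
    IsDensityMatrix (vecMulVec v (star v)) := by
  refine ⟨posSemidef_vecMulVec_self_star v, ?_⟩
  simpa [Matrix.trace, vecMulVec_apply] using hv

omit [DecidableEq n] in
theorem mul_vecMulVec_star_mul_conjTranspose_apply (M : Matrix n n ℂ) (v : n → ℂ) (p q : n) :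
    (M * vecMulVec v (star v) * Mᴴ) p q = (M *ᵥ v) p * star ((M *ᵥ v) q) := by
  rw [mul_vecMulVec, vecMulVec_mul, vecMulVec_apply, ← star_mulVec]
  rfl

/-- If the Kraus operators `M i` implement the identity channel, each of them is a scalar. -/
theorem eq_smul_one_of_kraus_identity {M : r → Matrix n n ℂ}
    (h : ∀ ρ, IsDensityMatrix ρ → ∑ x, M x * ρ * (M x)ᴴ = ρ) (x : r) :
    ∃ c : ℂ, M x = c • (1 : Matrix n n ℂ) := by
  have key : ∀ v : n → ℂ, ∑ i, v i * star (v i) = 1 → ∀ p q,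
      ∑ y, (M y *ᵥ v) p * star ((M y *ᵥ v) q) = v p * star (v q) := by
    intro v hv p q
    have := congrFun (congrFun (h _ (isDensityMatrix_vecMulVec hv)) p) q
    rw [Matrix.sum_apply] at this
    simpa only [mul_vecMulVec_star_mul_conjTranspose_apply, vecMulVec_apply, Pi.star_apply]
      using this
  have zero_of_sum : ∀ g : r → ℂ, ∑ y, g y * star (g y) = 0 → ∀ y, g y = 0 := by
    intro g hg y
    have h1 : ∀ y ∈ Finset.univ, (0 : ℂ) ≤ g y * star (g y) := fun y _ => mul_star_self_nonneg _
    have := (Finset.sum_eq_zero_iff_of_nonneg h1).1 hg y (Finset.mem_univ _)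
    simpa using this
  have single : ∀ i p q, ∑ y, M y p i * star (M y q i) =
      (if p = i then 1 else 0) * (if q = i then 1 else 0) := by
    intro i p q
    have := key (Pi.single i 1) (by simp [Pi.single_apply]) p q
    simpa [Pi.single_apply, apply_ite] using this
  have diag : ∀ i p, p ≠ i → ∀ y, M y p i = 0 := by
    intro i p hp
    apply zero_of_sum
    rw [single i p p]
    simp [hp]
  -- The superposition of two basis states gives `∑ M_ii conj(M_kk) = 1`, so `∑ |M_ii - M_kk|² = 1 -
  -- 1 - 1 + 1 = 0`.
  have eqd : ∀ i k, i ≠ k → ∀ y, M y i i = M y k k := by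
    intro i k hik
    have hs : ((Real.sqrt 2 : ℝ) : ℂ)⁻¹ * ((Real.sqrt 2 : ℝ) : ℂ)⁻¹ = 1 / 2 := by
      rw [← mul_inv, ← Complex.ofReal_mul, Real.mul_self_sqrt (by norm_num)]
      norm_num
    set s : ℂ := ((Real.sqrt 2 : ℝ) : ℂ)⁻¹ with hsdef
    have hstar : star s = s := by simp [hsdef]
    have hv1 : ∑ j, (s • (Pi.single i 1 + Pi.single k 1) : n → ℂ) j *
        star ((s • (Pi.single i 1 + Pi.single k 1) : n → ℂ) j) = 1 := by
      have : ∀ j, (s • (Pi.single i 1 + Pi.single k 1) : n → ℂ) j *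
          star ((s • (Pi.single i 1 + Pi.single k 1) : n → ℂ) j) =
          (1 / 2) * (if j = i then 1 else 0) + (1 / 2) * (if j = k then 1 else 0) := by
        intro j
        rw [Pi.smul_apply, smul_eq_mul, star_mul', hstar, ← hs]
        by_cases h1 : j = i
        · subst h1; simp [hik]
        · by_cases h2 : j = k
          · subst h2; simp [h1]
          · simp [h1, h2]
      simp only [this, Finset.sum_add_distrib, ← Finset.mul_sum]
      simp; norm_num
    have hMi : ∀ y, (M y *ᵥ (s • (Pi.single i 1 + Pi.single k 1) : n → ℂ)) i = s * M y i i := by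
      intro y
      simp [mulVec_smul, mulVec_add, diag k i hik y]
    have hMk : ∀ y, (M y *ᵥ (s • (Pi.single i 1 + Pi.single k 1) : n → ℂ)) k = s * M y k k := by
      intro y
      simp [mulVec_smul, mulVec_add, diag i k hik.symm y]
    have vi : (s • (Pi.single i 1 + Pi.single k 1) : n → ℂ) i = s := by
      simp [hik]
    have vk : (s • (Pi.single i 1 + Pi.single k 1) : n → ℂ) k = s := by
      simp [hik.symm]
    have hs0 : s * s ≠ 0 := by rw [hs]; norm_num
    have cross : ∀ p q, (∀ y, (M y *ᵥ (s • (Pi.single i 1 + Pi.single k 1) : n → ℂ)) p =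
        s * M y p p) → (∀ y, (M y *ᵥ (s • (Pi.single i 1 + Pi.single k 1) : n → ℂ)) q =
        s * M y q q) → (s • (Pi.single i 1 + Pi.single k 1) : n → ℂ) p = s →
        (s • (Pi.single i 1 + Pi.single k 1) : n → ℂ) q = s →
        ∑ y, M y p p * star (M y q q) = 1 := by
      intro p q h1 h2 h3 h4
      have := key _ hv1 p q
      rw [h3, h4] at this
      simp only [h1, h2, star_mul', hstar] at this
      have h5 : s * s * ∑ y, M y p p * star (M y q q) = s * s * 1 := by
        refine Eq.trans ?_ (this.trans (mul_one _).symm)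
        rw [Finset.mul_sum]
        exact Finset.sum_congr rfl fun y _ => by ring
      exact mul_left_cancel₀ hs0 h5
    intro y
    refine sub_eq_zero.1 (zero_of_sum (fun y => M y i i - M y k k) ?_ y)
    have e : ∀ y, (M y i i - M y k k) * star (M y i i - M y k k) =
        M y i i * star (M y i i) - M y i i * star (M y k k) - M y k k * star (M y i i) +
          M y k k * star (M y k k) := by
      intro y; rw [star_sub]; ring
    simp only [e, Finset.sum_add_distrib, Finset.sum_sub_distrib]
    rw [cross i i hMi hMi vi vi, cross i k hMi hMk vi vk, cross k i hMk hMi vk vi,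
      cross k k hMk hMk vk vk]
    ring
  rcases isEmpty_or_nonempty n with hn | ⟨⟨i0⟩⟩
  · exact ⟨0, Subsingleton.elim _ _⟩
  · refine ⟨M x i0 i0, ?_⟩
    ext p q
    by_cases hpq : p = q
    · subst hpq
      by_cases hp : p = i0
      · subst hp; simp
      · simpa using eqd p i0 hp x
    · simp [diag q p hpq x, hpq]

/-- If the Kraus operators `K i` implement the channel of the unitary `F`, each of them is a
multiple of `F`. -/
theorem eq_smul_of_kraus_unitary {K : r → Matrix n n ℂ} {F : Matrix n n ℂ}
    (hF : F ∈ unitaryGroup n ℂ)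
    (h : ∀ ρ, IsDensityMatrix ρ → ∑ x, K x * ρ * (K x)ᴴ = F * ρ * Fᴴ) (x : r) :
    ∃ c : ℂ, K x = c • F := by
  have hF1 : Fᴴ * F = 1 := mem_unitaryGroup_iff'.1 hF
  have hF2 : F * Fᴴ = 1 := mem_unitaryGroup_iff.1 hF
  obtain ⟨c, hc⟩ := eq_smul_one_of_kraus_identity (M := fun y => Fᴴ * K y) (by
    intro ρ hρ
    calc ∑ y, Fᴴ * K y * ρ * (Fᴴ * K y)ᴴ = Fᴴ * (∑ y, K y * ρ * (K y)ᴴ) * F := by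
          rw [Finset.mul_sum, Finset.sum_mul]
          refine Finset.sum_congr rfl fun y _ => ?_
          rw [conjTranspose_mul, conjTranspose_conjTranspose]
          simp only [Matrix.mul_assoc]
      _ = (Fᴴ * F) * ρ * (Fᴴ * F) := by rw [h ρ hρ]; simp only [Matrix.mul_assoc]
      _ = ρ := by rw [hF1]; simp) x
  refine ⟨c, ?_⟩
  calc K x = F * (Fᴴ * K x) := by rw [← Matrix.mul_assoc, hF2, Matrix.one_mul]
    _ = c • F := by simp only [hc]; simp

end KrausOperators

/-! ### Circuits with arbitrary query matrices, and purification -/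

section SeqCircuit

variable {n κ : Type} [Fintype n] [DecidableEq n] [Fintype κ] [DecidableEq κ]

/-- The circuit with gates `W 0, …, W k` and `k` queries to an arbitrary matrix `U`. -/
def seqCircuit (W : ℕ → Matrix (n × κ) (n × κ) ℂ) (U : Matrix n n ℂ) :
    ℕ → Matrix (n × κ) (n × κ) ℂ
  | 0 => W 0
  | k + 1 => W (k + 1) * (U ⊗ₖ (1 : Matrix κ κ ℂ)) * seqCircuit W U k

/-- The Kraus operators of the circuit with `k` queries, for the auxiliary state `a` and
the outcome `j` on the auxiliary system. -/
def krausOp (W : ℕ → Matrix (n × κ) (n × κ) ℂ) (a : κ → ℂ) (U : Matrix n n ℂ) (k : ℕ) (j : κ) :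
    Matrix n n ℂ :=
  of fun p i => ∑ q, seqCircuit W U k (p, j) (i, q) * a q

theorem circuit_eq_seqCircuit {d m : ℕ} (N : ℕ)
    (V : Fin (N + 1) → unitaryGroup (Fin d × Fin m) ℂ)
    (W : ℕ → Matrix (Fin d × Fin m) (Fin d × Fin m) ℂ)
    (h : ∀ k : Fin (N + 1), W k = V k) (U : SU d) :
    circuit N V U = seqCircuit W U N := by
  induction N with
  | zero => exact (h 0).symm
  | succ N ih =>
    rw [circuit, seqCircuit, ih (fun k => V k.castSucc) fun k => h k.castSucc]
    rw [← h (Fin.last (N + 1))]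
    rfl

theorem kronecker_one_conjTranspose_mul_self {U : Matrix n n ℂ} (hU : Uᴴ * U = 1) :
    (U ⊗ₖ (1 : Matrix κ κ ℂ))ᴴ * (U ⊗ₖ (1 : Matrix κ κ ℂ)) = 1 := by
  rw [conjTranspose_kronecker, conjTranspose_one, ← mul_kronecker_mul, hU, Matrix.mul_one,
    one_kronecker_one]

theorem seqCircuit_conjTranspose_mul_self {W : ℕ → Matrix (n × κ) (n × κ) ℂ}
    (hW : ∀ k, (W k)ᴴ * W k = 1) {U : Matrix n n ℂ} (hU : Uᴴ * U = 1) (k : ℕ) :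
    (seqCircuit W U k)ᴴ * seqCircuit W U k = 1 := by
  induction k with
  | zero => exact hW 0
  | succ k ih =>
    calc (seqCircuit W U (k + 1))ᴴ * seqCircuit W U (k + 1)
        = (seqCircuit W U k)ᴴ * ((U ⊗ₖ (1 : Matrix κ κ ℂ))ᴴ * ((W (k + 1))ᴴ * W (k + 1)) *
          (U ⊗ₖ (1 : Matrix κ κ ℂ))) * seqCircuit W U k := by
          simp only [seqCircuit, conjTranspose_mul, Matrix.mul_assoc]
      _ = 1 := by
          rw [hW, Matrix.mul_one, kronecker_one_conjTranspose_mul_self hU, Matrix.mul_one, ih]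

end SeqCircuit

theorem _root_.Matrix.PosSemidef.exists_eq_mul_conjTranspose {n : Type} [Fintype n]
    [DecidableEq n] {A : Matrix n n ℂ} (hA : A.PosSemidef) : ∃ B : Matrix n n ℂ, A = B * Bᴴ := by
  open scoped MatrixOrder in
  obtain ⟨B, hB⟩ := CStarAlgebra.nonneg_iff_eq_mul_star_self.1 hA.nonneg
  exact ⟨B, hB⟩

/-- An implementation can be purified: the auxiliary system starts in a vector state, and every
Kraus operator of the whole circuit is a multiple of `f U`. -/
theorem Implementable.exists_pure {d : ℕ} {f : SU d → SU d} {N : ℕ} (h : Implementable f N) :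
    ∃ (m : ℕ) (a : Fin m → ℂ) (W : ℕ → Matrix (Fin d × Fin m) (Fin d × Fin m) ℂ),
      ∑ q, star (a q) * a q = 1 ∧ (∀ k, (W k)ᴴ * W k = 1) ∧
      ∀ U : SU d, ∃ φ : Fin m → ℂ, ∀ j, krausOp W a U N j = φ j • (f U : Matrix _ _ ℂ) := by
  obtain ⟨m, ρA, V, ⟨hpos, htr⟩, hV⟩ := h
  obtain ⟨B, rfl⟩ : ∃ B : Matrix (Fin m) (Fin m) ℂ, ρA = B * Bᴴ :=
    hpos.exists_eq_mul_conjTranspose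
  -- The columns of `B` are an unnormalised ensemble for the auxiliary state; any nonzero one can
  -- replace that state.
  obtain ⟨k, hk⟩ : ∃ k, ∑ q, star (B q k) * B q k ≠ 0 := by
    by_contra! hcon
    have : (B * Bᴴ).trace = 0 := by
      rw [Matrix.trace_mul_comm]
      simp only [Matrix.trace, diag_apply, mul_apply, conjTranspose_apply]
      exact Finset.sum_eq_zero fun k _ => hcon k
    rw [this] at htr
    exact zero_ne_one htr
  have hreal : ∑ q, star (B q k) * B q k = ((∑ q, Complex.normSq (B q k) : ℝ) : ℂ) := by
    push_cast
    exact Finset.sum_congr rfl fun q _ => by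
      rw [Complex.normSq_eq_conj_mul_self]; rfl
  set s : ℝ := ∑ q, Complex.normSq (B q k) with hs
  have hs0 : 0 ≤ s := Finset.sum_nonneg fun q _ => Complex.normSq_nonneg _
  have hs1 : s ≠ 0 := by
    intro h0; rw [hreal, h0] at hk; exact hk (by simp)
  -- Only gates `0, …, N` matter; clamping the index by `min` keeps every later gate unitary.
  refine ⟨m, fun q => ((Real.sqrt s)⁻¹ : ℝ) * B q k,
    fun l => V ⟨min l N, by omega⟩, ?_, fun l => ?_, fun U => ?_⟩
  · have : ∀ q, star ((((Real.sqrt s)⁻¹ : ℝ) : ℂ) * B q k) * ((((Real.sqrt s)⁻¹ : ℝ) : ℂ) * B q k)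
        = ((s⁻¹ : ℝ) : ℂ) * (star (B q k) * B q k) := by
      intro q
      have e : (((Real.sqrt s)⁻¹ : ℝ) : ℂ) * (((Real.sqrt s)⁻¹ : ℝ) : ℂ) = ((s⁻¹ : ℝ) : ℂ) := by
        rw [← Complex.ofReal_mul, ← mul_inv, Real.mul_self_sqrt hs0]
      rw [star_mul', ← e]
      have : star (((Real.sqrt s)⁻¹ : ℝ) : ℂ) = (((Real.sqrt s)⁻¹ : ℝ) : ℂ) := Complex.conj_ofReal _
      rw [this]; ring
    simp only [this]
    rw [← Finset.mul_sum, hreal, ← Complex.ofReal_mul, inv_mul_cancel₀ hs1, Complex.ofReal_one]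
  · exact mem_unitaryGroup_iff'.1 (V _).2
  · have hZ := circuit_eq_seqCircuit N V (fun l => V ⟨min l N, by omega⟩) (fun k => by
      congr 3; omega) U
    set Z := seqCircuit
      (fun l => (V ⟨min l N, by omega⟩ : Matrix (Fin d × Fin m) (Fin d × Fin m) ℂ))
      (U : Matrix (Fin d) (Fin d) ℂ) N with hZdef
    -- One Kraus operator per pair of an auxiliary outcome and an ensemble member.
    let K : Fin m × Fin m → Matrix (Fin d) (Fin d) ℂ := fun y =>
      of fun p i => ∑ q, Z (p, y.1) (i, q) * B q y.2
    have hK := eq_smul_of_kraus_unitary (K := K) (f U).2.1 (by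
      intro ρ hρ
      rw [← hV U ρ hρ, hZ]
      have hY : Z * (ρ ⊗ₖ (B * Bᴴ)) * Zᴴ =
          (Z * ((1 : Matrix (Fin d) (Fin d) ℂ) ⊗ₖ B)) * (ρ ⊗ₖ (1 : Matrix (Fin m) (Fin m) ℂ)) *
          (Z * ((1 : Matrix (Fin d) (Fin d) ℂ) ⊗ₖ B))ᴴ := by
        have : ρ ⊗ₖ (B * Bᴴ) = ((1 : Matrix (Fin d) (Fin d) ℂ) ⊗ₖ B) *
            (ρ ⊗ₖ (1 : Matrix (Fin m) (Fin m) ℂ)) * ((1 : Matrix (Fin d) (Fin d) ℂ) ⊗ₖ B)ᴴ := by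
          rw [conjTranspose_kronecker, conjTranspose_one, ← mul_kronecker_mul,
            ← mul_kronecker_mul]
          simp
        rw [this, conjTranspose_mul]
        simp only [Matrix.mul_assoc]
      have hYe : ∀ p j i l, (Z * ((1 : Matrix (Fin d) (Fin d) ℂ) ⊗ₖ B)) (p, j) (i, l) =
          K (j, l) p i := by
        intro p j i l
        simp [K, mul_apply, Fintype.sum_prod_type, one_apply]
      rw [hY]
      generalize Z * ((1 : Matrix (Fin d) (Fin d) ℂ) ⊗ₖ B) = Y at hYe
      ext p p'
      simp only [partialTrace, of_apply, Matrix.sum_apply, mul_apply, Fintype.sum_prod_type,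
        conjTranspose_apply, kroneckerMap_apply, one_apply, hYe]
      refine Finset.sum_congr rfl fun j _ => ?_
      rw [Finset.sum_comm]
      simp)
    choose c hc using hK
    refine ⟨fun j => ((Real.sqrt s)⁻¹ : ℝ) * c (j, k), fun j => ?_⟩
    rw [mul_smul, ← hc]
    ext p i
    simp only [krausOp, of_apply, Matrix.smul_apply, K, smul_eq_mul, Finset.mul_sum]
    exact Finset.sum_congr rfl fun q _ => by ring

/-! ### Entrywise derivatives of matrix curves, and curves in `SU(d)` -/

section EntryDeriv

variable {l m n : Type}

/-- The entries of the matrix curve `A` have derivatives at `0` given by the entries of `A'`. -/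
def HasEntryDeriv (A : ℝ → Matrix m n ℂ) (A' : Matrix m n ℂ) : Prop :=
  ∀ i j, HasDerivAt (fun t => A t i j) (A' i j) 0

theorem HasEntryDeriv.const (A : Matrix m n ℂ) : HasEntryDeriv (fun _ => A) 0 := fun i j => by
  simpa using hasDerivAt_const (0 : ℝ) (A i j)

theorem HasEntryDeriv.mul [Fintype m] {A : ℝ → Matrix l m ℂ} {A' : Matrix l m ℂ}
    {B : ℝ → Matrix m n ℂ} {B' : Matrix m n ℂ} (hA : HasEntryDeriv A A')
    (hB : HasEntryDeriv B B') :
    HasEntryDeriv (fun t => A t * B t) (A' * B 0 + A 0 * B') := fun i j => by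
  have := HasDerivAt.fun_sum fun k (_ : k ∈ Finset.univ) => (hA i k).fun_mul (hB k j)
  simpa only [mul_apply, Matrix.add_apply, Finset.sum_add_distrib] using this

theorem HasEntryDeriv.const_mul [Fintype m] (A : Matrix l m ℂ)
    {B : ℝ → Matrix m n ℂ} {B' : Matrix m n ℂ} (hB : HasEntryDeriv B B') :
    HasEntryDeriv (fun t => A * B t) (A * B') := by
  simpa using (HasEntryDeriv.const A).mul hB

theorem HasEntryDeriv.mul_const [Fintype m] {A : ℝ → Matrix l m ℂ} {A' : Matrix l m ℂ}
    (hA : HasEntryDeriv A A') (B : Matrix m n ℂ) :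
    HasEntryDeriv (fun t => A t * B) (A' * B) := by
  simpa using hA.mul (HasEntryDeriv.const B)

theorem HasEntryDeriv.transpose {A : ℝ → Matrix m n ℂ} {A' : Matrix m n ℂ}
    (hA : HasEntryDeriv A A') : HasEntryDeriv (fun t => (A t)ᵀ) A'ᵀ := fun i j => hA j i

theorem HasEntryDeriv.conjTranspose {A : ℝ → Matrix m n ℂ} {A' : Matrix m n ℂ}
    (hA : HasEntryDeriv A A') : HasEntryDeriv (fun t => (A t)ᴴ) A'ᴴ := fun i j =>
  (hA j i).star

theorem HasEntryDeriv.kronecker_one {κ : Type} [DecidableEq κ] {A : ℝ → Matrix m n ℂ}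
    {A' : Matrix m n ℂ} (hA : HasEntryDeriv A A') :
    HasEntryDeriv (fun t => A t ⊗ₖ (1 : Matrix κ κ ℂ)) (A' ⊗ₖ 1) := fun i j =>
  (hA i.1 j.1).mul_const _

theorem HasEntryDeriv.unique {A : ℝ → Matrix m n ℂ} {A' A'' : Matrix m n ℂ}
    (h : HasEntryDeriv A A') (h' : HasEntryDeriv A A'') : A' = A'' := by
  ext i j
  exact (h i j).unique (h' i j)

end EntryDeriv

/-- Every traceless Hermitian matrix generates a curve in `SU(d)`. -/
theorem exists_curve {d : ℕ} {H : Matrix (Fin d) (Fin d) ℂ} (hH : H.IsHermitian)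
    (htr : H.trace = 0) :
    ∃ u : ℝ → SU d, u 0 = 1 ∧
      HasEntryDeriv (fun t => (u t : Matrix (Fin d) (Fin d) ℂ)) (Complex.I • H) := by
  let P : Matrix (Fin d) (Fin d) ℂ := hH.eigenvectorUnitary
  have hP : P * Pᴴ = 1 := mem_unitaryGroup_iff.1 hH.eigenvectorUnitary.2
  have hP' : Pᴴ * P = 1 := mem_unitaryGroup_iff'.1 hH.eigenvectorUnitary.2
  have hspec : H = P * diagonal (fun i => (hH.eigenvalues i : ℂ)) * Pᴴ := by
    have := hH.spectral_theorem
    exact this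
  have hsum : ∑ i, (hH.eigenvalues i : ℂ) = 0 := by
    rw [← htr, hH.trace_eq_sum_eigenvalues]; rfl
  -- The curve is `P exp(itΛ) P†`; the eigenvalues sum to zero, which makes the determinant one.
  let D : ℝ → Matrix (Fin d) (Fin d) ℂ := fun t =>
    diagonal fun i => Complex.exp (t * (Complex.I * hH.eigenvalues i))
  have hDD : ∀ t, D t * (D t)ᴴ = 1 := by
    intro t
    rw [diagonal_conjTranspose, diagonal_mul_diagonal, ← diagonal_one]
    congr 1
    funext i
    have : star (Complex.exp (t * (Complex.I * hH.eigenvalues i))) =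
        Complex.exp (-(t * (Complex.I * hH.eigenvalues i))) := by
      have := Complex.exp_conj (t * (Complex.I * hH.eigenvalues i))
      simp only [map_mul, Complex.conj_ofReal, Complex.conj_I] at this
      rw [Complex.star_def, ← this]
      congr 1; ring
    rw [Pi.star_apply, this, ← Complex.exp_add, add_neg_cancel, Complex.exp_zero]
  have hdet : ∀ t, (D t).det = 1 := by
    intro t
    rw [det_diagonal, ← Complex.exp_sum, ← Finset.mul_sum, ← Finset.mul_sum, hsum]
    simp
  refine ⟨fun t => ⟨P * D t * Pᴴ, mem_specialUnitaryGroup_iff.2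
    ⟨mem_unitaryGroup_iff.2 ?_, ?_⟩⟩, ?_, ?_⟩
  · rw [star_eq_conjTranspose]
    calc P * D t * Pᴴ * (P * D t * Pᴴ)ᴴ = P * (D t * (Pᴴ * P) * (D t)ᴴ) * Pᴴ := by
          simp only [conjTranspose_mul, conjTranspose_conjTranspose, Matrix.mul_assoc]
      _ = 1 := by rw [hP', Matrix.mul_one, hDD, Matrix.mul_one, hP]
  · rw [det_mul, det_mul, hdet, mul_one, ← det_mul, hP, det_one]
  · ext1
    simp [D, hP]
  · have hD : HasEntryDeriv D (Complex.I • diagonal (fun i => (hH.eigenvalues i : ℂ))) := by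
      intro i j
      by_cases hij : i = j
      · subst hij
        have h1 : HasDerivAt (fun t : ℝ => (t : ℂ) * (Complex.I * hH.eigenvalues i))
            (Complex.I * hH.eigenvalues i) 0 := by
          simpa using (Complex.ofRealCLM.hasDerivAt (x := (0 : ℝ))).mul_const
            (Complex.I * (hH.eigenvalues i : ℂ))
        simpa [D] using h1.cexp
      · simpa [D, hij] using hasDerivAt_const (0 : ℝ) (0 : ℂ)
    have := (hD.const_mul P).mul_const Pᴴ
    rw [hspec]
    simpa using this

/-! ### The derivative of a circuit -/

section Derivative

variable {n κ : Type} [Fintype n] [DecidableEq n] [Fintype κ] [DecidableEq κ]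

/-- The product rule gives one term per query. Inserting `C C† = 1` pulls the full circuit to the
left, so each query contributes `A` in the Heisenberg picture, conjugated by the circuit that
precedes it. -/
theorem hasEntryDeriv_seqCircuit {W : ℕ → Matrix (n × κ) (n × κ) ℂ}
    (hW : ∀ k, (W k)ᴴ * W k = 1) {U₀ : Matrix n n ℂ} (hU₀ : U₀ᴴ * U₀ = 1)
    {u : ℝ → Matrix n n ℂ} (hu0 : u 0 = 1) {A : Matrix n n ℂ} (hu : HasEntryDeriv u A) (N : ℕ) :
    HasEntryDeriv (fun t => seqCircuit W (U₀ * u t) N)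
      (seqCircuit W U₀ N * ∑ k ∈ Finset.range N,
        (seqCircuit W U₀ k)ᴴ * (A ⊗ₖ (1 : Matrix κ κ ℂ)) * seqCircuit W U₀ k) := by
  induction N with
  | zero => simpa [seqCircuit] using HasEntryDeriv.const (W 0)
  | succ N ih =>
    have h1 := ((hu.const_mul U₀).kronecker_one (κ := κ)).const_mul (W (N + 1))
    have h2 := h1.mul ih
    simp only [hu0, Matrix.mul_one] at h2
    convert h2 using 1
    · rfl
    have hC := seqCircuit_conjTranspose_mul_self hW hU₀ N
    have hC' : seqCircuit W U₀ N * (seqCircuit W U₀ N)ᴴ = 1 := mul_eq_one_comm.1 hC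
    rw [Finset.sum_range_succ, Matrix.mul_add, add_comm]
    congr 1
    · have : (U₀ * A) ⊗ₖ (1 : Matrix κ κ ℂ) = (U₀ ⊗ₖ 1) * (A ⊗ₖ 1) := by
        rw [← mul_kronecker_mul, Matrix.mul_one]
      rw [this]
      calc _ = W (N + 1) * (U₀ ⊗ₖ 1) * (seqCircuit W U₀ N * (seqCircuit W U₀ N)ᴴ) *
            (A ⊗ₖ 1) * seqCircuit W U₀ N := by
            simp only [seqCircuit, Matrix.mul_assoc]
        _ = _ := by rw [hC', Matrix.mul_one]; simp only [Matrix.mul_assoc]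
    · simp only [seqCircuit, Matrix.mul_assoc]

/-- The embedding `ψ ↦ ψ ⊗ a`. -/
def tensorRight (n : Type) [DecidableEq n] (a : κ → ℂ) : Matrix (n × κ) n ℂ :=
  of fun x i => if x.1 = i then a x.2 else 0

theorem seqCircuit_mul_tensorRight_apply (W : ℕ → Matrix (n × κ) (n × κ) ℂ) (a : κ → ℂ)
    (U : Matrix n n ℂ) (k : ℕ) (p : n) (j : κ) (i : n) :
    (seqCircuit W U k * tensorRight n a) (p, j) i = krausOp W a U k j p i := by
  simp only [tensorRight, krausOp, mul_apply, of_apply, Fintype.sum_prod_type]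
  rw [Finset.sum_eq_single i]
  · simp
  · intro b _ hb; simp [hb]
  · simp

omit [DecidableEq κ] in
theorem tensorRight_conjTranspose_mul_self {a : κ → ℂ} (ha : ∑ q, star (a q) * a q = 1) :
    (tensorRight n a)ᴴ * tensorRight n a = 1 := by
  ext i j
  simp only [tensorRight, mul_apply, conjTranspose_apply, of_apply, Fintype.sum_prod_type]
  by_cases hij : i = j
  · subst hij
    rw [Finset.sum_eq_single i]
    · simpa using ha
    · intro b _ hb; simp [hb]
    · simp
  · rw [one_apply_ne hij]
    refine Finset.sum_eq_zero fun p _ => Finset.sum_eq_zero fun q _ => ?_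
    by_cases h : p = i
    · subst h; simp [hij]
    · simp [h]

/-- Summing over auxiliary outcomes resolves the identity on the auxiliary factor. Two independent
query matrices are allowed because both the derivative and the second-query argument for
transposition compare different ones. -/
theorem sum_krausOp_conjTranspose_mul_mul (W : ℕ → Matrix (n × κ) (n × κ) ℂ) (a : κ → ℂ)
    (U U' : Matrix n n ℂ) (k : ℕ) (X : Matrix n n ℂ) :
    ∑ j, (krausOp W a U k j)ᴴ * X * krausOp W a U' k j =
      (tensorRight n a)ᴴ * ((seqCircuit W U k)ᴴ * (X ⊗ₖ (1 : Matrix κ κ ℂ)) *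
        seqCircuit W U' k) * tensorRight n a := by
  have : (tensorRight n a)ᴴ * ((seqCircuit W U k)ᴴ * (X ⊗ₖ (1 : Matrix κ κ ℂ)) *
        seqCircuit W U' k) * tensorRight n a = (seqCircuit W U k * tensorRight n a)ᴴ *
        (X ⊗ₖ (1 : Matrix κ κ ℂ)) * (seqCircuit W U' k * tensorRight n a) := by
    simp only [conjTranspose_mul, Matrix.mul_assoc]
  rw [this]
  ext i i'
  simp only [Matrix.sum_apply, mul_apply, conjTranspose_apply, Fintype.sum_prod_type,
    ← seqCircuit_mul_tensorRight_apply, kroneckerMap_apply, one_apply]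
  rw [Finset.sum_comm]
  simp

theorem sum_krausOp_conjTranspose_mul_self {W : ℕ → Matrix (n × κ) (n × κ) ℂ}
    (hW : ∀ k, (W k)ᴴ * W k = 1) {a : κ → ℂ} (ha : ∑ q, star (a q) * a q = 1)
    {U : Matrix n n ℂ} (hU : Uᴴ * U = 1) (k : ℕ) :
    ∑ j, (krausOp W a U k j)ᴴ * krausOp W a U k j = 1 := by
  have := sum_krausOp_conjTranspose_mul_mul W a U U k 1
  simp only [Matrix.mul_one, one_kronecker_one] at this
  rw [this, seqCircuit_conjTranspose_mul_self hW hU, Matrix.mul_one,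
    tensorRight_conjTranspose_mul_self ha]

end Derivative

/-! ### The infinitesimal exactness condition -/

section Choi

variable {d m N : ℕ} {f : SU d → SU d} {a : Fin m → ℂ}
  {W : ℕ → Matrix (Fin d × Fin m) (Fin d × Fin m) ℂ}

theorem SU.conjTranspose_mul_self (U : SU d) :
    (U : Matrix (Fin d) (Fin d) ℂ)ᴴ * (U : Matrix (Fin d) (Fin d) ℂ) = 1 :=
  mem_unitaryGroup_iff'.1 U.2.1

theorem SU.mul_conjTranspose_self (U : SU d) :
    (U : Matrix (Fin d) (Fin d) ℂ) * (U : Matrix (Fin d) (Fin d) ℂ)ᴴ = 1 :=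
  mem_unitaryGroup_iff.1 U.2.1

/-- The derivative of the implementation condition along a curve through `U₀`. -/
theorem exists_sum_krausOp_eq_deriv (ha : ∑ q, star (a q) * a q = 1)
    (hW : ∀ k, (W k)ᴴ * W k = 1)
    (hf : ∀ U : SU d, ∃ φ : Fin m → ℂ, ∀ j, krausOp W a U N j = φ j • (f U : Matrix _ _ ℂ))
    (U₀ : SU d) {u : ℝ → SU d} (hu0 : u 0 = 1) {A : Matrix (Fin d) (Fin d) ℂ}
    (hu : HasEntryDeriv (fun t => (u t : Matrix (Fin d) (Fin d) ℂ)) A)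
    {F' : Matrix (Fin d) (Fin d) ℂ}
    (hF : HasEntryDeriv (fun t => (f U₀ : Matrix (Fin d) (Fin d) ℂ)ᴴ *
      (f (U₀ * u t) : Matrix (Fin d) (Fin d) ℂ)) F') :
    ∃ c : ℂ, ∑ k ∈ Finset.range N, ∑ j, (krausOp W a U₀ k j)ᴴ * A * krausOp W a U₀ k j =
      F' + c • 1 := by
  rcases isEmpty_or_nonempty (Fin d) with hd | ⟨⟨i₀⟩⟩
  · exact ⟨0, Subsingleton.elim _ _⟩
  choose φ hφ using hf
  let F : ℝ → Matrix (Fin d) (Fin d) ℂ := fun t => (f U₀ : Matrix (Fin d) (Fin d) ℂ)ᴴ *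
      (f (U₀ * u t) : Matrix (Fin d) (Fin d) ℂ)
  let s : ℝ → ℂ := fun t => ∑ j, star (φ U₀ j) * φ (U₀ * u t) j
  let R : ℝ → Matrix (Fin d) (Fin d) ℂ := fun t => (tensorRight (Fin d) a)ᴴ *
    ((seqCircuit W U₀ N)ᴴ * seqCircuit W (U₀ * u t : SU d) N) * tensorRight (Fin d) a
  have hR : ∀ t, R t = s t • F t := by
    intro t
    have := sum_krausOp_conjTranspose_mul_mul W a U₀ (U₀ * u t : SU d) N 1
    simp only [Matrix.mul_one, one_kronecker_one] at this
    change (tensorRight (Fin d) a)ᴴ *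
    ((seqCircuit W U₀ N)ᴴ * seqCircuit W (U₀ * u t : SU d) N) * tensorRight (Fin d) a = _
    rw [← this]
    simp only [hφ, conjTranspose_smul, smul_mul, Matrix.mul_smul, smul_smul, s, F,
      Finset.sum_smul]
    exact Finset.sum_congr rfl fun j _ => by rw [mul_comm]
  have hRd : HasEntryDeriv R
      (∑ k ∈ Finset.range N, ∑ j, (krausOp W a U₀ k j)ᴴ * A * krausOp W a U₀ k j) := by
    have h1 := hasEntryDeriv_seqCircuit hW (SU.conjTranspose_mul_self U₀)
      (u := fun t => (u t : Matrix (Fin d) (Fin d) ℂ)) (by simp [hu0]) hu N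
    have h2 := ((h1.const_mul (seqCircuit W U₀ N)ᴴ).const_mul
      (tensorRight (Fin d) a)ᴴ).mul_const (tensorRight (Fin d) a)
    convert h2 using 1
    · rfl
    rw [← Matrix.mul_assoc (seqCircuit W U₀ N)ᴴ,
      seqCircuit_conjTranspose_mul_self hW (SU.conjTranspose_mul_self U₀), Matrix.one_mul,
      Matrix.mul_sum, Matrix.sum_mul]
    exact Finset.sum_congr rfl fun k _ => sum_krausOp_conjTranspose_mul_mul W a U₀ U₀ k A
  have hFF : ∀ t, (F t)ᴴ * F t = 1 := by
    intro t
    calc (F t)ᴴ * F t = (f (U₀ * u t) : Matrix (Fin d) (Fin d) ℂ)ᴴ *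
        ((f U₀ : Matrix (Fin d) (Fin d) ℂ) * (f U₀ : Matrix (Fin d) (Fin d) ℂ)ᴴ) *
        (f (U₀ * u t) : Matrix (Fin d) (Fin d) ℂ) := by
          simp only [F, conjTranspose_mul, conjTranspose_conjTranspose, Matrix.mul_assoc]
      _ = 1 := by rw [SU.mul_conjTranspose_self, Matrix.mul_one, SU.conjTranspose_mul_self]
  have hF0 : F 0 = 1 := by simp [F, hu0, SU.conjTranspose_mul_self]
  have hR0 : R 0 = 1 := by
    simp only [R, hu0, mul_one]
    rw [seqCircuit_conjTranspose_mul_self hW (SU.conjTranspose_mul_self U₀), Matrix.mul_one,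
      tensorRight_conjTranspose_mul_self ha]
  have hs0 : s 0 = 1 := by
    have := hR 0
    rw [hF0, hR0] at this
    simpa using (congrFun (congrFun this i₀) i₀).symm
  -- The coefficients `φ` come from a choice without regularity; `s` is differentiable only because
  -- it is an entry of a product of differentiable curves.
  have hs : ∀ t, s t = ((F t)ᴴ * R t) i₀ i₀ := by
    intro t
    rw [hR, Matrix.mul_smul, hFF]
    simp
  obtain ⟨s', hs'⟩ : ∃ s', HasDerivAt s s' 0 := by
    have := (HasEntryDeriv.conjTranspose hF).mul hRd i₀ i₀
    exact ⟨_, this.congr_of_eventuallyEq (Filter.Eventually.of_forall hs)⟩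
  refine ⟨s', hRd.unique ?_⟩
  intro i j
  have h3 : HasDerivAt (fun t => s t * F t i j) (s' * F 0 i j + s 0 * F' i j) 0 :=
    hs'.fun_mul (hF i j)
  rw [hF0, hs0] at h3
  simp only [hR, Matrix.smul_apply, smul_eq_mul]
  convert h3 using 1
  simp [add_comm]

/-- If `f` is infinitesimally `G` at `U₀`, the Choi matrix of the sum of the channels seen by the
queries is that of `G` up to a term `β ⊗ 1`. -/
theorem exists_choi (ha : ∑ q, star (a q) * a q = 1) (hW : ∀ k, (W k)ᴴ * W k = 1)
    (hf : ∀ U : SU d, ∃ φ : Fin m → ℂ, ∀ j, krausOp W a U N j = φ j • (f U : Matrix _ _ ℂ))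
    (hd : 1 ≤ d) (U₀ : SU d)
    (G : Matrix (Fin d) (Fin d) ℂ →ₗ[ℂ] Matrix (Fin d) (Fin d) ℂ) {γ : ℂ} (hG1 : G 1 = γ • 1)
    (hG : ∀ H : Matrix (Fin d) (Fin d) ℂ, H.IsHermitian → ∀ u : ℝ → SU d,
      HasEntryDeriv (fun t => (u t : Matrix (Fin d) (Fin d) ℂ)) (Complex.I • H) →
      HasEntryDeriv (fun t => (f U₀ : Matrix (Fin d) (Fin d) ℂ)ᴴ *
        (f (U₀ * u t) : Matrix (Fin d) (Fin d) ℂ)) (Complex.I • G H)) :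
    ∃ β : Matrix (Fin d) (Fin d) ℂ, β.trace = N - γ ∧ ∀ p q,
      ∑ k ∈ Finset.range N, ∑ j, (krausOp W a U₀ k j)ᴴ * single p q 1 * krausOp W a U₀ k j =
        G (single p q 1) + β p q • 1 := by
  let i₀ : Fin d := ⟨0, hd⟩
  let E : Matrix (Fin d) (Fin d) ℂ →ₗ[ℂ] Matrix (Fin d) (Fin d) ℂ :=
    { toFun := fun X =>
        ∑ k ∈ Finset.range N, ∑ j, (krausOp W a U₀ k j)ᴴ * X * krausOp W a U₀ k j
      map_add' := fun X Y => by
        simp only [Matrix.mul_add, Matrix.add_mul, Finset.sum_add_distrib]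
      map_smul' := fun c X => by
        simp only [Matrix.mul_smul, smul_mul, Finset.smul_sum, RingHom.id_apply] }
  let T := E - G
  -- `S` collects the matrices on which `E - G` is scalar. It is a complex subspace, so it is
  -- everything once it contains `1` and the traceless Hermitian matrices, the directions of curves
  -- in `SU(d)`.
  let S : Submodule ℂ (Matrix (Fin d) (Fin d) ℂ) := (ℂ ∙ (1 : Matrix (Fin d) (Fin d) ℂ)).comap T
  have memS : ∀ X, X ∈ S ↔ ∃ c : ℂ, c • 1 = T X := fun X => Submodule.mem_span_singleton
  have hT1 : T 1 = (N - γ) • 1 := by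
    have : E 1 = (N : ℂ) • 1 := by
      change ∑ k ∈ Finset.range N, ∑ j, (krausOp W a U₀ k j)ᴴ * 1 * krausOp W a U₀ k j = _
      simp only [Matrix.mul_one,
        sum_krausOp_conjTranspose_mul_self hW ha (SU.conjTranspose_mul_self U₀)]
      rw [Finset.sum_const, Finset.card_range, Nat.cast_smul_eq_nsmul]
    rw [LinearMap.sub_apply, this, hG1, sub_smul]
  have h1S : (1 : Matrix (Fin d) (Fin d) ℂ) ∈ S := (memS 1).2 ⟨_, hT1.symm⟩
  have hHS : ∀ H : Matrix (Fin d) (Fin d) ℂ, H.IsHermitian → H.trace = 0 → H ∈ S := by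
    intro H hH htr
    obtain ⟨u, hu0, hu⟩ := exists_curve hH htr
    obtain ⟨c, hc⟩ := exists_sum_krausOp_eq_deriv ha hW hf U₀ hu0 hu (hG H hH u hu)
    have hc' : E (Complex.I • H) = G (Complex.I • H) + c • 1 := by
      rw [map_smul G]; exact hc
    have : Complex.I • H ∈ S := (memS _).2 ⟨c, by rw [LinearMap.sub_apply, hc']; simp⟩
    have h2 := S.smul_mem (-Complex.I) this
    rwa [smul_smul, neg_mul, Complex.I_mul_I, neg_neg, one_smul] at h2
  have hHS' : ∀ H : Matrix (Fin d) (Fin d) ℂ, H.IsHermitian → H ∈ S := by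
    intro H hH
    have hd0 : (d : ℂ) ≠ 0 := Nat.cast_ne_zero.2 (by omega)
    have hreal : star H.trace = H.trace := by
      rw [← trace_conjTranspose, hH.eq]
    have : H - (H.trace / d) • 1 ∈ S := by
      apply hHS
      · refine hH.sub ?_
        rw [IsHermitian, conjTranspose_smul, conjTranspose_one]
        congr 1
        rw [star_div₀, hreal]; simp
      · rw [trace_sub, trace_smul, trace_one]
        simp [div_mul_cancel₀ _ hd0]
    simpa using S.add_mem this (S.smul_mem (H.trace / d) h1S)
  have hall : ∀ X, X ∈ S := by
    intro X
    have e1 : X = (1 / 2 : ℂ) • (X + Xᴴ) + (-Complex.I / 2) • (Complex.I • (X - Xᴴ)) := by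
      ext i j
      simp only [Matrix.add_apply, Matrix.smul_apply, Matrix.sub_apply, smul_eq_mul]
      linear_combination (1 / 2 * (X i j - Xᴴ i j)) * Complex.I_mul_I
    rw [e1]
    refine S.add_mem (S.smul_mem _ (hHS' _ ?_)) (S.smul_mem _ (hHS' _ ?_))
    · rw [IsHermitian, conjTranspose_add, conjTranspose_conjTranspose, add_comm]
    · rw [IsHermitian, conjTranspose_smul, conjTranspose_sub, conjTranspose_conjTranspose]
      ext i j
      simp
      ring
  have hval : ∀ X, T X = (T X) i₀ i₀ • 1 := by
    intro X
    obtain ⟨c, hc⟩ := (memS X).1 (hall X)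
    rw [← hc]; simp
  refine ⟨of fun p q => T (single p q 1) i₀ i₀, ?_, ?_⟩
  · have : (1 : Matrix (Fin d) (Fin d) ℂ) = ∑ p, single p p 1 := by
      ext i j
      by_cases hij : i = j
      · subst hij; simp [Matrix.sum_apply, single_apply]
      · simp only [Matrix.sum_apply, one_apply_ne hij]
        exact (Finset.sum_eq_zero fun p _ => single_apply_of_ne _ _ _ _ _ (by grind)).symm
    simp only [Matrix.trace, diag_apply, of_apply]
    rw [← Matrix.sum_apply, ← map_sum, ← this, hT1]
    simp
  · intro p q
    rw [of_apply, ← hval]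
    exact (add_sub_cancel (G (single p q 1)) (E (single p q 1))).symm

theorem conjTranspose_mul_single_mul_apply (A : Matrix (Fin d) (Fin d) ℂ) (p q i i' : Fin d) :
    (Aᴴ * single p q 1 * A : Matrix (Fin d) (Fin d) ℂ) i i' = star (A p i) * A q i' := by
  rw [Matrix.mul_assoc, mul_apply, Finset.sum_eq_single p]
  · simp
  · intro b _ hb; simp [hb]
  · simp

/-- The identity of `exists_choi` with the Kraus operators multiplied by a unitary `M` from the
right. -/
theorem sum_star_mul_of_choi {r : Type} {s : Finset r} {K : r → Matrix (Fin d) (Fin d) ℂ}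
    {p q : Fin d} {Y : Matrix (Fin d) (Fin d) ℂ} {b : ℂ}
    (h : ∑ x ∈ s, (K x)ᴴ * single p q 1 * K x = Y + b • 1) {M : Matrix (Fin d) (Fin d) ℂ}
    (hM : Mᴴ * M = 1) (i i' : Fin d) :
    ∑ x ∈ s, star ((K x * M) p i) * (K x * M) q i' =
      (Mᴴ * Y * M) i i' + b * (1 : Matrix (Fin d) (Fin d) ℂ) i i' := by
  have h1 : ∑ x ∈ s, (K x * M)ᴴ * single p q 1 * (K x * M) = Mᴴ * Y * M + b • 1 := by
    calc _ = Mᴴ * (∑ x ∈ s, (K x)ᴴ * single p q 1 * K x) * M := by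
          rw [Matrix.mul_sum, Matrix.sum_mul]
          exact Finset.sum_congr rfl fun x _ => by
            simp only [conjTranspose_mul, Matrix.mul_assoc]
      _ = _ := by rw [h, Matrix.mul_add, Matrix.add_mul, Matrix.mul_smul, smul_mul,
                    Matrix.mul_one, hM]
  simp only [← conjTranspose_mul_single_mul_apply, ← Matrix.sum_apply]
  rw [h1]
  rfl

end Choi

/-! ### Unitary 1-designs -/

section Design

/-- Take a `d`-th root of the conjugate determinant. -/
theorem exists_smul_mem_specialUnitaryGroup {d : ℕ} (hd : 1 ≤ d) {U : Matrix (Fin d) (Fin d) ℂ}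
    (hU : U ∈ unitaryGroup (Fin d) ℂ) :
    ∃ z : ℂ, z * star z = 1 ∧ z • U ∈ specialUnitaryGroup (Fin d) ℂ := by
  have hdet : star U.det * U.det = 1 := by
    rw [← det_conjTranspose, ← det_mul, ← star_eq_conjTranspose, mem_unitaryGroup_iff'.1 hU,
      det_one]
  obtain ⟨z, hz⟩ := IsAlgClosed.exists_pow_nat_eq (star U.det) hd
  have hz1 : z * star z = 1 := by
    have h1 : ‖U.det‖ = 1 := by
      have := congrArg norm hdet
      rw [norm_mul, norm_star, norm_one] at this
      nlinarith [norm_nonneg U.det]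
    have h2 : ‖z‖ = 1 := by
      have := congrArg norm hz
      rw [norm_pow, norm_star, h1] at this
      exact (pow_eq_one_iff_of_nonneg (norm_nonneg z) (by omega)).1 this
    rw [Complex.star_def, Complex.mul_conj, Complex.normSq_eq_norm_sq, h2]
    simp
  refine ⟨z, hz1, mem_specialUnitaryGroup_iff.2 ⟨mem_unitaryGroup_iff.2 ?_, ?_⟩⟩
  · rw [star_smul, smul_mul, Matrix.mul_smul, smul_smul, hz1, one_smul]
    exact mem_unitaryGroup_iff.1 hU
  · rw [det_smul, Fintype.card_fin, hz, hdet]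

/-- A finite family of special unitaries through `U₀` with the first moments of the Haar measure
(a unitary 1-design). -/
theorem exists_design {d : ℕ} (hd : 1 ≤ d) (U₀ : SU d) :
    ∃ (Γ : Type) (_ : Fintype Γ) (g : Γ → SU d) (C : ℕ), 0 < C ∧ (∃ γ₀, g γ₀ = U₀) ∧
      Fintype.card Γ = C * d ∧ ∀ i l i' l',
        ∑ γ, (g γ : Matrix (Fin d) (Fin d) ℂ) i l * star ((g γ : Matrix (Fin d) (Fin d) ℂ) i' l') =
          C * ((1 : Matrix (Fin d) (Fin d) ℂ) i i' * (1 : Matrix (Fin d) (Fin d) ℂ) l l') := by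
  have : NeZero d := ⟨by omega⟩
  -- Signed cyclic shifts: averaging over signs kills products of entries from different rows, and
  -- exactly one shift reaches each position. The phases that correct the determinant cancel in
  -- first moments.
  let g₀ : (Fin d → ℤˣ) × Fin d → Matrix (Fin d) (Fin d) ℂ := fun x =>
    of fun i l => ((x.1 i : ℤ) : ℂ) * (if l = i + x.2 then 1 else 0)
  have hsq : ∀ e : ℤˣ, ((e : ℤ) : ℂ) * ((e : ℤ) : ℂ) = 1 := by
    intro e
    rw [← Int.cast_mul, ← Units.val_mul, Int.units_mul_self]; simp
  have hU : ∀ x, g₀ x ∈ unitaryGroup (Fin d) ℂ := by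
    intro x
    rw [mem_unitaryGroup_iff]
    ext i j
    rw [star_eq_conjTranspose, mul_apply, Finset.sum_eq_single (i + x.2)]
    · by_cases hij : i = j
      · subst hij
        simp [g₀, hsq]
      · simp [g₀, hij]
    · intro b _ hb
      simp [g₀, hb]
    · simp
  choose z hz hzU using fun x => exists_smul_mem_specialUnitaryGroup hd (hU x)
  let h : (Fin d → ℤˣ) × Fin d → SU d := fun x => ⟨z x • g₀ x, hzU x⟩
  have hsign : ∀ i i' : Fin d, ∑ s : Fin d → ℤˣ, ((s i : ℤ) : ℂ) * ((s i' : ℤ) : ℂ) =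
      (2 ^ d : ℕ) * (1 : Matrix (Fin d) (Fin d) ℂ) i i' := by
    intro i i'
    by_cases hii : i = i'
    · subst hii
      simp [hsq]
    · rw [one_apply_ne hii, mul_zero]
      have := (Equiv.sum_comp (Equiv.mulRight (Pi.mulSingle i (-1 : ℤˣ)))
        (fun s : Fin d → ℤˣ => ((s i : ℤ) : ℂ) * ((s i' : ℤ) : ℂ)))
      simp only [Equiv.coe_mulRight, Pi.mul_apply, Pi.mulSingle_eq_same,
        Pi.mulSingle_eq_of_ne (Ne.symm hii)] at this
      simp only [mul_neg, mul_one, Units.val_neg, Int.cast_neg, neg_mul,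
        Finset.sum_neg_distrib] at this
      exact self_eq_neg.1 this.symm
  have hh : ∀ i l i' l', ∑ γ, (h γ : Matrix (Fin d) (Fin d) ℂ) i l *
      star ((h γ : Matrix (Fin d) (Fin d) ℂ) i' l') =
      (2 ^ d : ℕ) * ((1 : Matrix (Fin d) (Fin d) ℂ) i i' * (1 : Matrix (Fin d) (Fin d) ℂ) l l') := by
    intro i l i' l'
    let c : Fin d → ℂ := fun b => (if l = i + b then 1 else 0) * (if l' = i' + b then 1 else 0)
    have e1 : ∀ γ, (h γ : Matrix (Fin d) (Fin d) ℂ) i l *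
        star ((h γ : Matrix (Fin d) (Fin d) ℂ) i' l') =
        (((γ.1 i : ℤ) : ℂ) * ((γ.1 i' : ℤ) : ℂ)) * c γ.2 := by
      intro γ
      have : star (((γ.1 i' : ℤ) : ℂ)) = ((γ.1 i' : ℤ) : ℂ) := by simp
      have h3 : star (if l' = i' + γ.2 then (1 : ℂ) else 0) = if l' = i' + γ.2 then 1 else 0 := by
        split_ifs <;> simp
      calc _ = (z γ * star (z γ)) * ((((γ.1 i : ℤ) : ℂ) * (if l = i + γ.2 then 1 else 0)) *
          star (((γ.1 i' : ℤ) : ℂ) * (if l' = i' + γ.2 then 1 else 0))) := by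
            simp only [h, g₀, Matrix.smul_apply, of_apply, smul_eq_mul, star_mul']
            ring
        _ = _ := by rw [hz, star_mul', this, h3]; simp only [c]; ring
    simp only [e1, Fintype.sum_prod_type, ← Finset.mul_sum]
    rw [← Finset.sum_mul, hsign]
    by_cases hii : i = i'
    · subst hii
      rw [one_apply_eq]
      have : ∑ b, c b =
          (1 : Matrix (Fin d) (Fin d) ℂ) l l' := by
        rw [Finset.sum_eq_single (l - i)]
        · simp [c, one_apply, eq_comm]
        · intro b _ hb
          simp only [c]
          rw [if_neg, zero_mul]
          rintro rfl
          exact hb (by simp)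
        · simp
      rw [this]; ring
    · rw [one_apply_ne hii]; ring
  let γ₀ : (Fin d → ℤˣ) × Fin d := (1, 0)
  -- Right translation by a unitary preserves these moments and moves one member to `U₀`.
  refine ⟨_, inferInstance, fun γ => h γ * ((h γ₀)⁻¹ * U₀), 2 ^ d, by positivity,
    ⟨γ₀, by group⟩, by simp, fun i l i' l' => ?_⟩
  generalize (h γ₀)⁻¹ * U₀ = T
  have hT := SU.conjTranspose_mul_self T
  have e2 : ∀ γ, ((h γ * T : SU d) : Matrix (Fin d) (Fin d) ℂ) i l *
      star (((h γ * T : SU d) : Matrix (Fin d) (Fin d) ℂ) i' l') =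
      ∑ m, ∑ m', (T.1 m l * star (T.1 m' l')) * ((h γ).1 i m * star ((h γ).1 i' m')) := by
    intro γ
    change ((h γ).1 * T.1) i l * star (((h γ).1 * T.1) i' l') = _
    rw [mul_apply, mul_apply, star_sum, Finset.sum_mul_sum]
    refine Finset.sum_congr rfl fun m _ => Finset.sum_congr rfl fun m' _ => ?_
    rw [star_mul']; ring
  simp only [e2]
  rw [Finset.sum_comm]
  have e3 : ∀ m, ∑ γ, ∑ m', (T.1 m l * star (T.1 m' l')) * ((h γ).1 i m * star ((h γ).1 i' m')) =
      (2 ^ d : ℕ) * ((1 : Matrix (Fin d) (Fin d) ℂ) i i') * (T.1 m l * star (T.1 m l')) := by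
    intro m
    rw [Finset.sum_comm]
    simp only [← Finset.mul_sum, hh]
    rw [Finset.sum_eq_single m]
    · rw [one_apply_eq]; ring
    · intro b _ hb; rw [one_apply_ne hb.symm]; ring
    · simp
  simp only [e3]
  rw [← Finset.mul_sum]
  have : ∑ m, T.1 m l * star (T.1 m l') = (1 : Matrix (Fin d) (Fin d) ℂ) l l' := by
    have := congrFun (congrFun hT l') l
    rw [mul_apply] at this
    have hsymm : (1 : Matrix (Fin d) (Fin d) ℂ) l l' = (1 : Matrix (Fin d) (Fin d) ℂ) l' l := by
      simp [one_apply, eq_comm]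
    rw [hsymm, ← this]
    exact Finset.sum_congr rfl fun m _ => mul_comm _ _
  rw [this]; ring

/-- The first moments of a 1-design recover each entry of `K` from these traces. -/
theorem eq_zero_of_trace_mul_SU_eq_zero {d : ℕ} (hd : 1 ≤ d) {K : Matrix (Fin d) (Fin d) ℂ}
    (h : ∀ U : SU d, (K * (U : Matrix (Fin d) (Fin d) ℂ)).trace = 0) : K = 0 := by
  obtain ⟨Γ, _, g, C, hC, -, -, hg⟩ := exists_design hd 1
  ext p i
  have h1 : ∑ γ, (K * (g γ : Matrix (Fin d) (Fin d) ℂ)).trace *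
      star ((g γ : Matrix (Fin d) (Fin d) ℂ) i p) = C * K p i := by
    simp only [Matrix.trace, diag_apply, mul_apply, Finset.sum_mul]
    rw [Finset.sum_comm]
    have : ∀ q, ∑ γ, ∑ l, K q l * (g γ : Matrix (Fin d) (Fin d) ℂ) l q *
        star ((g γ : Matrix (Fin d) (Fin d) ℂ) i p) =
        C * (K q i * (1 : Matrix (Fin d) (Fin d) ℂ) q p) := by
      intro q
      rw [Finset.sum_comm]
      simp only [mul_assoc, ← Finset.mul_sum, hg]
      rw [Finset.sum_eq_single i]
      · rw [one_apply_eq]; ring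
      · intro b _ hb; rw [one_apply_ne hb]; ring
      · simp
    simp only [this, ← Finset.mul_sum]
    simp [one_apply]
  simp only [h, zero_mul, Finset.sum_const_zero] at h1
  have hC0 : (C : ℂ) ≠ 0 := Nat.cast_ne_zero.2 hC.ne'
  simpa [hC0] using h1.symm

end Design

/-! ### Lower bound for inversion -/

section Inversion

theorem inversion_lower_bound {d N : ℕ} (hd : 2 ≤ d) (h : Implementable (inversion d) N) :
    d ^ 2 ≤ N := by
  obtain ⟨m, a, W, ha, hW, hf⟩ := h.exists_pure
  have hinv : ∀ U : SU d, (inversion d U : Matrix (Fin d) (Fin d) ℂ) =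
    (U : Matrix (Fin d) (Fin d) ℂ)ᴴ := fun U => rfl
  have key : ∀ U : SU d, ∑ k ∈ Finset.range N, ∑ j,
      star (krausOp W a U k j * (U : Matrix (Fin d) (Fin d) ℂ)).trace *
        (krausOp W a U k j * (U : Matrix (Fin d) (Fin d) ℂ)).trace = N + 1 - (d : ℂ) ^ 2 := by
    intro U
    obtain ⟨β, hβ, hK⟩ := exists_choi ha hW hf (by omega) U
      (-(LinearMap.mulRight ℂ (U : Matrix (Fin d) (Fin d) ℂ)ᴴ ∘ₗ
        LinearMap.mulLeft ℂ (U : Matrix (Fin d) (Fin d) ℂ))) (γ := -1)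
      (by simp [SU.mul_conjTranspose_self]) (by
        intro H hH u hu
        simp only [hinv, conjTranspose_conjTranspose]
        have h1 := ((hu.const_mul (U : Matrix (Fin d) (Fin d) ℂ)).conjTranspose).const_mul
          (U : Matrix (Fin d) (Fin d) ℂ)
        convert h1 using 1
        · rfl
        simp [conjTranspose_smul, hH.eq, Matrix.mul_assoc])
    have hL : ∀ p q i i', ∑ x ∈ Finset.range N ×ˢ Finset.univ,
        star ((krausOp W a U x.1 x.2 * (U : Matrix (Fin d) (Fin d) ℂ)) p i) *
          (krausOp W a U x.1 x.2 * (U : Matrix (Fin d) (Fin d) ℂ)) q i' =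
        - (single p q 1 : Matrix (Fin d) (Fin d) ℂ) i i' +
          β p q * (1 : Matrix (Fin d) (Fin d) ℂ) i i' := by
      intro p q i i'
      have hpq := hK p q
      rw [← Finset.sum_product'] at hpq
      rw [sum_star_mul_of_choi hpq (SU.conjTranspose_mul_self U)]
      congr 1
      have : (U : Matrix (Fin d) (Fin d) ℂ)ᴴ * -((U : Matrix (Fin d) (Fin d) ℂ) *
          single p q 1 * (U : Matrix (Fin d) (Fin d) ℂ)ᴴ) * (U : Matrix (Fin d) (Fin d) ℂ) =
          - single p q 1 := by
        calc _ = - (((U : Matrix (Fin d) (Fin d) ℂ)ᴴ * (U : Matrix (Fin d) (Fin d) ℂ)) *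
            single p q 1 * ((U : Matrix (Fin d) (Fin d) ℂ)ᴴ * (U : Matrix (Fin d) (Fin d) ℂ))) := by
              simp only [Matrix.mul_neg, Matrix.neg_mul, Matrix.mul_assoc]
          _ = _ := by rw [SU.conjTranspose_mul_self]; simp
      exact congrFun (congrFun this i) i'
    rw [← Finset.sum_product']
    simp only [Matrix.trace, diag_apply, star_sum, Finset.sum_mul_sum]
    rw [Finset.sum_comm]
    have : ∀ p, ∑ x ∈ Finset.range N ×ˢ Finset.univ, ∑ q,
        star ((krausOp W a U x.1 x.2 * (U : Matrix (Fin d) (Fin d) ℂ)) p p) *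
          (krausOp W a U x.1 x.2 * (U : Matrix (Fin d) (Fin d) ℂ)) q q = - d + β p p := by
      intro p
      rw [Finset.sum_comm]
      simp only [hL, Finset.sum_add_distrib, Finset.sum_neg_distrib]
      simp [one_apply]
    simp only [this, Finset.sum_add_distrib]
    have htr : ∑ p, β p p = N + 1 := by
      have := hβ
      simp only [Matrix.trace, diag_apply, sub_neg_eq_add] at this
      exact this
    rw [htr]
    simp
    ring
  have hnonneg : ∀ (U : SU d) (k : ℕ) (j : Fin m), 0 ≤
      star (krausOp W a U k j * (U : Matrix (Fin d) (Fin d) ℂ)).trace *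
        (krausOp W a U k j * (U : Matrix (Fin d) (Fin d) ℂ)).trace :=
    fun U k j => star_mul_self_nonneg _
  have h1 : d ^ 2 ≤ N + 1 := by
    have : (0 : ℂ) ≤ N + 1 - (d : ℂ) ^ 2 := by
      rw [← key 1]
      exact Finset.sum_nonneg fun k _ => Finset.sum_nonneg fun j _ => hnonneg 1 k j
    rw [sub_nonneg] at this
    exact_mod_cast this
  by_contra hcon
  have h2 : (N : ℂ) + 1 - (d : ℂ) ^ 2 = 0 := by
    have : N + 1 = d ^ 2 := by omega
    rw [sub_eq_zero]
    exact_mod_cast this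
  have hN : 0 < N := by nlinarith
  have hz : ∀ j, krausOp W a 1 0 j = 0 := by
    intro j
    refine eq_zero_of_trace_mul_SU_eq_zero (by omega) fun U => ?_
    have h3 := (Finset.sum_eq_zero_iff_of_nonneg fun k _ =>
      Finset.sum_nonneg fun j _ => hnonneg U k j).1 ((key U).trans h2) 0 (by simpa using hN)
    have h4 := (Finset.sum_eq_zero_iff_of_nonneg fun j _ => hnonneg U 0 j).1 h3 j
      (Finset.mem_univ _)
    -- Before any query the Kraus operators do not see `U`, so `1` may be replaced by `U`.
    change (krausOp W a U 0 j * (U : Matrix (Fin d) (Fin d) ℂ)).trace = 0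
    simpa using h4
  have h5 := sum_krausOp_conjTranspose_mul_self hW ha
    (U := (1 : Matrix (Fin d) (Fin d) ℂ)) (by simp) 0
  simp only [hz] at h5
  have := congrFun (congrFun h5 ⟨0, by omega⟩) ⟨0, by omega⟩
  simp at this

end Inversion

/-! ### Lower bound for conjugation -/

section Conjugation

theorem conjugation_lower_bound {d N : ℕ} (hd : 1 ≤ d) (h : Implementable (conjugation d) N) :
    d - 1 ≤ N := by
  obtain ⟨m, a, W, ha, hW, hf⟩ := h.exists_pure
  have hconj : ∀ U : SU d, (conjugation d U : Matrix (Fin d) (Fin d) ℂ) =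
    (U : Matrix (Fin d) (Fin d) ℂ)ᴴᵀ := fun U => rfl
  obtain ⟨β, hβ, hK⟩ := exists_choi ha hW hf hd 1
    (-(transposeLinearEquiv (Fin d) (Fin d) ℂ ℂ).toLinearMap) (γ := -1) (by simp) (by
      intro H hH u hu
      simp only [hconj, one_mul]
      have h1 := hu.conjTranspose.transpose
      convert h1 using 1
      · ext t : 1; simp
      · simp [conjTranspose_smul, hH.eq])
  have hp : ∀ p, 1 ≤ β p p := by
    intro p
    have h1 := congrFun (congrFun (hK p p) p) p
    have h2 : 0 ≤ (∑ k ∈ Finset.range N, ∑ j, (krausOp W a (1 : SU d) k j)ᴴ * single p p 1 *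
        krausOp W a (1 : SU d) k j : Matrix (Fin d) (Fin d) ℂ) p p := by
      simp only [Matrix.sum_apply, conjTranspose_mul_single_mul_apply]
      exact Finset.sum_nonneg fun k _ => Finset.sum_nonneg fun j _ => star_mul_self_nonneg _
    rw [h1] at h2
    simpa using h2
  have : (d : ℂ) ≤ N + 1 := by
    have h3 : ∑ p : Fin d, (1 : ℂ) ≤ ∑ p, β p p := Finset.sum_le_sum fun p _ => hp p
    have h4 : ∑ p, β p p = N + 1 := by
      have := hβ
      simp only [Matrix.trace, diag_apply, sub_neg_eq_add] at this
      exact this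
    rw [h4] at h3
    simpa using h3
  have : d ≤ N + 1 := by exact_mod_cast this
  omega

end Conjugation

/-! ### Asymmetry and the bound `d + 2` for transposition -/

section Transposition

variable {d m N : ℕ}

/-- The squared Hilbert–Schmidt norm of the antisymmetric part (times two) of `L`. -/
def asymmetry (L : Matrix (Fin d) (Fin d) ℂ) : ℂ :=
  ∑ p, ∑ l, star (L p l - L l p) * (L p l - L l p)

theorem asymmetry_nonneg (L : Matrix (Fin d) (Fin d) ℂ) : 0 ≤ asymmetry L :=
  Finset.sum_nonneg fun _ _ => Finset.sum_nonneg fun _ _ => star_mul_self_nonneg _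

theorem transpose_eq_of_asymmetry_eq_zero {L : Matrix (Fin d) (Fin d) ℂ}
    (h : asymmetry L = 0) : Lᵀ = L := by
  ext l p
  have h1 := (Finset.sum_eq_zero_iff_of_nonneg fun p _ =>
    Finset.sum_nonneg fun _ _ => star_mul_self_nonneg _).1 h p (Finset.mem_univ _)
  have h2 := (Finset.sum_eq_zero_iff_of_nonneg fun _ _ => star_mul_self_nonneg _).1 h1 l
    (Finset.mem_univ _)
  rcases mul_eq_zero.1 h2 with h3 | h3
  · exact sub_eq_zero.1 (star_eq_zero.1 h3)
  · exact sub_eq_zero.1 h3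

/-- Each pair `p ≠ l` contributes `β_pp + β_ll - 2c`, and the diagonal pairs contribute nothing. -/
theorem sum_asymmetry {r : Type} {s : Finset r} {L : r → Matrix (Fin d) (Fin d) ℂ} {c : ℂ}
    {β : Matrix (Fin d) (Fin d) ℂ}
    (h : ∀ p q i i', ∑ x ∈ s, star (L x p i) * L x q i' =
      c * (single q p 1 : Matrix (Fin d) (Fin d) ℂ) i i' +
        β p q * (1 : Matrix (Fin d) (Fin d) ℂ) i i') :
    ∑ x ∈ s, asymmetry (L x) = 2 * (d - 1) * (β.trace - c * d) := by
  have h1 : ∀ p l, ∑ x ∈ s, star (L x p l - L x l p) * (L x p l - L x l p) =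
      β p p + β l l - 2 * c + (2 * c - 2 * β p p) * (1 : Matrix (Fin d) (Fin d) ℂ) p l := by
    intro p l
    have e : ∀ x, star (L x p l - L x l p) * (L x p l - L x l p) =
        star (L x p l) * L x p l - star (L x p l) * L x l p -
          (star (L x l p) * L x p l - star (L x l p) * L x l p) := by
      intro x; rw [star_sub]; ring
    simp only [e, Finset.sum_sub_distrib, h]
    by_cases hpl : p = l
    · subst hpl; simp; ring
    · have hlp : ¬ l = p := fun h => hpl h.symm
      simp [one_apply, hpl, hlp]
      ring
  simp only [asymmetry]
  rw [Finset.sum_comm]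
  have h2 : ∀ p, ∑ x ∈ s, ∑ l, star (L x p l - L x l p) * (L x p l - L x l p) =
      d * β p p + β.trace - 2 * c * d + (2 * c - 2 * β p p) := by
    intro p
    rw [Finset.sum_comm]
    simp only [h1, Finset.sum_add_distrib, Finset.sum_sub_distrib, ← Finset.mul_sum]
    simp [one_apply, Matrix.trace]
    ring
  simp only [h2, Finset.sum_add_distrib, Finset.sum_sub_distrib, ← Finset.mul_sum]
  simp only [Matrix.trace, diag_apply, Finset.sum_const, Finset.card_univ, Fintype.card_fin,
    nsmul_eq_mul]
  ring

theorem conj_mul_conj {U : Matrix (Fin d) (Fin d) ℂ} (hU : Uᴴ * U = 1) :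
    (Uᴴᵀ)ᴴ * Uᴴᵀ = 1 := by
  have : (Uᴴᵀ)ᴴ = Uᵀ := by ext i j; simp
  rw [this, ← transpose_mul, hU, transpose_one]

theorem sum_asymmetry_transposition {a : Fin m → ℂ}
    {W : ℕ → Matrix (Fin d × Fin m) (Fin d × Fin m) ℂ} (hd : 1 ≤ d)
    (ha : ∑ q, star (a q) * a q = 1) (hW : ∀ k, (W k)ᴴ * W k = 1)
    (hf : ∀ U : SU d, ∃ φ : Fin m → ℂ, ∀ j,
      krausOp W a U N j = φ j • (transposition d U : Matrix _ _ ℂ)) (U : SU d) :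
    ∑ k ∈ Finset.range N, ∑ j,
      asymmetry (krausOp W a U k j * (U : Matrix (Fin d) (Fin d) ℂ)ᴴᵀ) =
        2 * (d - 1) * (N - 1 - d) := by
  have hT : ∀ U : SU d, (transposition d U : Matrix (Fin d) (Fin d) ℂ) =
    (U : Matrix (Fin d) (Fin d) ℂ)ᵀ := fun U => rfl
  have hconj : (U : Matrix (Fin d) (Fin d) ℂ)ᵀᴴ = (U : Matrix (Fin d) (Fin d) ℂ)ᴴᵀ := by
    ext i j; simp
  have hUU : (U : Matrix (Fin d) (Fin d) ℂ)ᴴᵀ * (U : Matrix (Fin d) (Fin d) ℂ)ᵀ = 1 := by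
    rw [← transpose_mul, SU.mul_conjTranspose_self, transpose_one]
  have hUU' : (U : Matrix (Fin d) (Fin d) ℂ)ᵀ * (U : Matrix (Fin d) (Fin d) ℂ)ᴴᵀ = 1 := by
    rw [← transpose_mul, SU.conjTranspose_mul_self, transpose_one]
  obtain ⟨β, hβ, hK⟩ := exists_choi ha hW hf hd U
    ((LinearMap.mulRight ℂ (U : Matrix (Fin d) (Fin d) ℂ)ᵀ ∘ₗ
        LinearMap.mulLeft ℂ (U : Matrix (Fin d) (Fin d) ℂ)ᴴᵀ) ∘ₗ
      (transposeLinearEquiv (Fin d) (Fin d) ℂ ℂ).toLinearMap) (γ := 1)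
    (by simp [hUU]) (by
      intro H hH u hu
      simp only [hT, hconj]
      have h1 := ((hu.const_mul (U : Matrix (Fin d) (Fin d) ℂ)).transpose).const_mul
        (U : Matrix (Fin d) (Fin d) ℂ)ᴴᵀ
      convert h1 using 1
      · rfl
      simp [Matrix.mul_assoc])
  have hL : ∀ p q i i', ∑ x ∈ Finset.range N ×ˢ Finset.univ,
      star ((krausOp W a U x.1 x.2 * (U : Matrix (Fin d) (Fin d) ℂ)ᴴᵀ) p i) *
        (krausOp W a U x.1 x.2 * (U : Matrix (Fin d) (Fin d) ℂ)ᴴᵀ) q i' =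
      1 * (single q p 1 : Matrix (Fin d) (Fin d) ℂ) i i' +
        β p q * (1 : Matrix (Fin d) (Fin d) ℂ) i i' := by
    intro p q i i'
    have hpq := hK p q
    rw [← Finset.sum_product'] at hpq
    rw [sum_star_mul_of_choi hpq (conj_mul_conj (SU.conjTranspose_mul_self U)), one_mul]
    congr 1
    have h2 : (U : Matrix (Fin d) (Fin d) ℂ)ᴴᵀᴴ = (U : Matrix (Fin d) (Fin d) ℂ)ᵀ := by
      ext i j; simp
    have : (U : Matrix (Fin d) (Fin d) ℂ)ᴴᵀᴴ * ((U : Matrix (Fin d) (Fin d) ℂ)ᴴᵀ *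
        (single p q 1)ᵀ * (U : Matrix (Fin d) (Fin d) ℂ)ᵀ) * (U : Matrix (Fin d) (Fin d) ℂ)ᴴᵀ =
        single q p 1 := by
      calc _ = ((U : Matrix (Fin d) (Fin d) ℂ)ᵀ * (U : Matrix (Fin d) (Fin d) ℂ)ᴴᵀ) *
          (single p q 1)ᵀ * ((U : Matrix (Fin d) (Fin d) ℂ)ᵀ *
            (U : Matrix (Fin d) (Fin d) ℂ)ᴴᵀ) := by
            rw [h2]; simp only [Matrix.mul_assoc]
        _ = _ := by rw [hUU']; simp
    exact congrFun (congrFun this i) i'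
  have h3 := sum_asymmetry hL
  rw [Finset.sum_product] at h3
  rw [h3, hβ]
  ring

/-- Averaged over a 1-design, the asymmetry of the Kraus operators of a fixed channel. -/
theorem sum_asymmetry_design {Γ : Type} [Fintype Γ] {g : Γ → SU d} {C : ℕ}
    (hg : ∀ i l i' l',
        ∑ γ, (g γ : Matrix (Fin d) (Fin d) ℂ) i l * star ((g γ : Matrix (Fin d) (Fin d) ℂ) i' l') =
          C * ((1 : Matrix (Fin d) (Fin d) ℂ) i i' * (1 : Matrix (Fin d) (Fin d) ℂ) l l'))
    {K : Fin m → Matrix (Fin d) (Fin d) ℂ} (hK : ∑ j, (K j)ᴴ * K j = 1) :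
    ∑ γ, ∑ j, asymmetry (K j * (g γ : Matrix (Fin d) (Fin d) ℂ)ᴴᵀ) = 2 * (d - 1) * (C * d) := by
  -- Twirling by the design leaves a Choi matrix of the form `β ⊗ 1`, so `sum_asymmetry` applies
  -- with `c = 0`.
  have hL : ∀ p q i i', ∑ x : Γ × Fin m,
      star ((K x.2 * (g x.1 : Matrix (Fin d) (Fin d) ℂ)ᴴᵀ) p i) *
        (K x.2 * (g x.1 : Matrix (Fin d) (Fin d) ℂ)ᴴᵀ) q i' =
      0 * (single q p 1 : Matrix (Fin d) (Fin d) ℂ) i i' +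
        ((of fun p q => C * ∑ j, ∑ i, star (K j p i) * K j q i : Matrix (Fin d) (Fin d) ℂ)) p q *
          (1 : Matrix (Fin d) (Fin d) ℂ) i i' := by
    intro p q l l'
    rw [zero_mul, zero_add, Fintype.sum_prod_type, Finset.sum_comm]
    simp only [of_apply, Finset.mul_sum, Finset.sum_mul]
    refine Finset.sum_congr rfl fun j _ => ?_
    have e1 : ∀ γ, star ((K j * (g γ : Matrix (Fin d) (Fin d) ℂ)ᴴᵀ) p l) *
        (K j * (g γ : Matrix (Fin d) (Fin d) ℂ)ᴴᵀ) q l' =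
        ∑ i, ∑ i', (star (K j p i) * K j q i') *
          ((g γ : Matrix (Fin d) (Fin d) ℂ) i l *
            star ((g γ : Matrix (Fin d) (Fin d) ℂ) i' l')) := by
      intro γ
      rw [mul_apply, mul_apply, star_sum, Finset.sum_mul_sum]
      refine Finset.sum_congr rfl fun i _ => Finset.sum_congr rfl fun i' _ => ?_
      simp only [star_mul', transpose_apply, conjTranspose_apply, star_star]
      ring
    simp only [e1]
    rw [Finset.sum_comm]
    refine Finset.sum_congr rfl fun i _ => ?_
    rw [Finset.sum_comm]
    simp only [← Finset.mul_sum, hg]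
    rw [Finset.sum_eq_single i]
    · rw [one_apply_eq]; ring
    · intro b _ hb; rw [one_apply_ne hb.symm]; ring
    · simp
  have h3 := sum_asymmetry hL
  rw [Fintype.sum_prod_type] at h3
  rw [h3, zero_mul, sub_zero]
  congr 1
  have h4 : (∑ j, (K j)ᴴ * K j).trace = d := by rw [hK]; simp
  simp only [Matrix.trace, diag_apply, of_apply, ← Finset.mul_sum]
  congr 1
  rw [← h4, Matrix.trace_sum, Finset.sum_comm]
  refine Finset.sum_congr rfl fun j _ => ?_
  simp only [Matrix.trace, diag_apply, mul_apply, conjTranspose_apply]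
  exact Finset.sum_comm

/-- For each `U` the total asymmetry is fixed, and the share of `k = 0` has a known average over a
design. What remains is nonnegative and proportional to `N - (d + 2)`. In the equality case every
remaining term vanishes; the design can be taken through any given `U`, so this holds pointwise. -/
theorem transposition_lower_bound_aux {a : Fin m → ℂ}
    {W : ℕ → Matrix (Fin d × Fin m) (Fin d × Fin m) ℂ} (hd : 2 ≤ d)
    (ha : ∑ q, star (a q) * a q = 1) (hW : ∀ k, (W k)ᴴ * W k = 1)
    (hf : ∀ U : SU d, ∃ φ : Fin m → ℂ, ∀ j,
      krausOp W a U N j = φ j • (transposition d U : Matrix _ _ ℂ)) :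
    d + 2 ≤ N ∧ (N = d + 2 → ∀ (U : SU d) (j : Fin m),
      ((U : Matrix (Fin d) (Fin d) ℂ) * krausOp W a U 1 j)ᵀ =
        (U : Matrix (Fin d) (Fin d) ℂ) * krausOp W a U 1 j) := by
  have key := sum_asymmetry_transposition (by omega) ha hW hf
  have hd1 : (0 : ℂ) < 2 * (d - 1) := by
    have : ((1 : ℕ) : ℂ) < (d : ℂ) := by exact_mod_cast (by omega : 1 < d)
    have : (0 : ℂ) < d - 1 := by simpa [sub_pos] using this
    positivity
  obtain rfl | ⟨N', rfl⟩ : N = 0 ∨ ∃ N', N = N' + 1 := by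
    cases N <;> simp
  · exfalso
    have h0 := key 1
    simp only [Finset.range_zero, Finset.sum_empty, Nat.cast_zero, zero_sub] at h0
    rcases mul_eq_zero.1 h0.symm with h | h
    · exact hd1.ne' h
    · have : ((1 + d : ℕ) : ℂ) = 0 := by push_cast; linear_combination -h
      rw [Nat.cast_eq_zero] at this
      omega
  have main : ∀ U₀ : SU d, ∃ (Γ : Type) (_ : Fintype Γ) (g : Γ → SU d) (C : ℕ), 0 < C ∧
      (∃ γ₀, g γ₀ = U₀) ∧ ∑ γ, ∑ k ∈ Finset.range N', ∑ j,
        asymmetry (krausOp W a (g γ) (k + 1) j * (g γ : Matrix (Fin d) (Fin d) ℂ)ᴴᵀ) =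
          (2 * (d - 1)) * ((C * d : ℕ) * (((N' + 1 : ℕ) : ℂ) - (d + 2 : ℕ))) := by
    intro U₀
    obtain ⟨Γ, _, g, C, hC, hγ₀, hcard, hg⟩ := exists_design (by omega : 1 ≤ d) U₀
    refine ⟨Γ, inferInstance, g, C, hC, hγ₀, ?_⟩
    have h1 := sum_asymmetry_design (K := fun j => krausOp W a 1 0 j) hg
      (sum_krausOp_conjTranspose_mul_self hW ha (by simp) 0)
    have h2 : ∑ γ, ∑ k ∈ Finset.range (N' + 1), ∑ j,
        asymmetry (krausOp W a (g γ) k j * (g γ : Matrix (Fin d) (Fin d) ℂ)ᴴᵀ) =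
        ∑ γ : Γ, (2 * (d - 1) * (((N' + 1 : ℕ) : ℂ) - 1 - d)) :=
      Finset.sum_congr rfl fun γ _ => key (g γ)
    simp only [Finset.sum_range_succ', Finset.sum_add_distrib] at h2
    rw [Finset.sum_const, Finset.card_univ, hcard, nsmul_eq_mul] at h2
    have h3 : ∑ γ, ∑ j, asymmetry (krausOp W a (g γ) 0 j *
        (g γ : Matrix (Fin d) (Fin d) ℂ)ᴴᵀ) = 2 * (d - 1) * (C * d) := h1
    rw [h3] at h2
    push_cast at h2 ⊢
    linear_combination h2
  have hnn : ∀ (U : SU d), 0 ≤ ∑ k ∈ Finset.range N', ∑ j,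
        asymmetry (krausOp W a U (k + 1) j * (U : Matrix (Fin d) (Fin d) ℂ)ᴴᵀ) := fun U =>
    Finset.sum_nonneg fun k _ => Finset.sum_nonneg fun j _ => asymmetry_nonneg _
  constructor
  · obtain ⟨Γ, _, g, C, hC, -, hsum⟩ := main 1
    have h4 : 0 ≤ (2 * ((d : ℂ) - 1)) * ((C * d : ℕ) * (((N' + 1 : ℕ) : ℂ) - (d + 2 : ℕ))) := by
      rw [← hsum]
      exact Finset.sum_nonneg fun γ _ => hnn _
    have h5 : 0 ≤ ((C * d : ℕ) : ℂ) * (((N' + 1 : ℕ) : ℂ) - (d + 2 : ℕ)) :=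
      le_of_mul_le_mul_left (by rw [mul_zero]; exact h4) hd1
    have hCd : (0 : ℂ) < ((C * d : ℕ) : ℂ) := by
      exact_mod_cast Nat.mul_pos hC (by omega)
    have h6 : 0 ≤ ((N' + 1 : ℕ) : ℂ) - (d + 2 : ℕ) :=
      le_of_mul_le_mul_left (by rw [mul_zero]; exact h5) hCd
    rw [sub_nonneg] at h6
    exact_mod_cast h6
  · intro hN U j
    obtain ⟨Γ, _, g, C, hC, ⟨γ₀, rfl⟩, hsum⟩ := main U
    rw [hN, sub_self, mul_zero, mul_zero] at hsum
    have h7 := (Finset.sum_eq_zero_iff_of_nonneg fun γ _ => hnn (g γ)).1 hsum γ₀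
      (Finset.mem_univ _)
    have h8 := (Finset.sum_eq_zero_iff_of_nonneg fun k _ => Finset.sum_nonneg fun j _ =>
      asymmetry_nonneg _).1 h7 0 (Finset.mem_range.2 (by omega))
    have h9 := (Finset.sum_eq_zero_iff_of_nonneg fun j _ => asymmetry_nonneg _).1 h8 j
      (Finset.mem_univ _)
    have h10 := transpose_eq_of_asymmetry_eq_zero h9
    simp only [zero_add] at h10
    set V : Matrix (Fin d) (Fin d) ℂ := (g γ₀ : Matrix (Fin d) (Fin d) ℂ) with hV
    set K := krausOp W a V 1 j
    have hVV : Vᴴᵀ * Vᵀ = 1 := by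
      rw [← transpose_mul, SU.mul_conjTranspose_self, transpose_one]
    -- A congruence of a symmetric matrix is symmetric.
    have hKV : V * K = V * (K * Vᴴᵀ) * Vᵀ := by
      rw [Matrix.mul_assoc, Matrix.mul_assoc K, hVV, Matrix.mul_one]
    rw [hKV, transpose_mul, transpose_mul, h10, transpose_transpose]
    simp only [Matrix.mul_assoc]

end Transposition

/-! ### Quadratic identities on the unitary group -/

section Polarization

/-- Orthonormal columns, given on a subset of the index set, extend to a unitary matrix. -/
theorem exists_unitary_of_orthonormal {ι : Type} [Fintype ι] [DecidableEq ι] {s : Set ι}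
    {v : ι → ι → ℂ}
    (h : ∀ i ∈ s, ∀ j ∈ s, ∑ x, star (v i x) * v j x = if i = j then 1 else 0) :
    ∃ V ∈ unitaryGroup ι ℂ, ∀ i ∈ s, ∀ x, V x i = v i x := by
  let w : ι → EuclideanSpace ℂ ι := fun i => WithLp.toLp 2 (v i)
  have hw : Orthonormal ℂ (s.domRestrict w) := by
    rw [orthonormal_iff_ite]
    rintro ⟨i, hi⟩ ⟨j, hj⟩
    have := h i hi j hj
    simp only [Set.domRestrict_apply, w, PiLp.inner_apply, RCLike.inner_apply, Subtype.mk.injEq]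
    rw [← this]
    exact Finset.sum_congr rfl fun x _ => mul_comm _ _
  obtain ⟨b, hb⟩ := hw.exists_orthonormalBasis_extension_of_card_eq (by simp)
  refine ⟨of fun x i => b i x, ?_, fun i hi x => ?_⟩
  · rw [mem_unitaryGroup_iff']
    ext i j
    have := orthonormal_iff_ite.1 b.orthonormal i j
    simp only [PiLp.inner_apply, RCLike.inner_apply] at this
    rw [star_eq_conjTranspose, mul_apply, one_apply, ← this]
    exact Finset.sum_congr rfl fun x _ => mul_comm _ _
  · rw [of_apply, hb i hi]

variable {d : ℕ} {E : Type} [AddCommGroup E] [Module ℂ E]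
  {B : Matrix (Fin d) (Fin d) ℂ →ₗ[ℂ] Matrix (Fin d) (Fin d) ℂ →ₗ[ℂ] E}

/-- Flipping the signs of two rows of `W` keeps it unitary; the alternating sum over the four sign
choices isolates the mixed term, with coefficient 8. -/
theorem apply_rows_eq_zero (hs : ∀ X Y, B X Y = B Y X)
    (h0 : ∀ U ∈ unitaryGroup (Fin d) ℂ, B U U = 0) {i k : Fin d} (hik : i ≠ k)
    {W : Matrix (Fin d) (Fin d) ℂ} (hW : W ∈ unitaryGroup (Fin d) ℂ) :
    B (single i i 1 * W) (single k k 1 * W) = 0 := by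
  set X := single i i 1 * W with hX
  set Y := single k k 1 * W with hY
  have hU : ∀ a b : ℂ, a * star a = 1 → b * star b = 1 →
      B ((W - X - Y) + a • X + b • Y) ((W - X - Y) + a • X + b • Y) = 0 := by
    intro a b ha hb
    apply h0
    have : (W - X - Y) + a • X + b • Y =
        diagonal (fun x => if x = i then a else if x = k then b else 1) * W := by
      ext x y
      simp only [hX, hY, Matrix.add_apply, Matrix.sub_apply, Matrix.smul_apply, diagonal_mul,
        smul_eq_mul]
      by_cases hxi : x = i
      · subst hxi
        simp [hik]
      · by_cases hxk : x = k
        · subst hxk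
          simp [hxi]
        · simp [hxi, hxk]
    rw [this]
    refine mul_mem ?_ hW
    rw [mem_unitaryGroup_iff, star_eq_conjTranspose, diagonal_conjTranspose,
      diagonal_mul_diagonal, ← diagonal_one]
    congr 1
    funext x
    simp only [Pi.star_apply]
    split_ifs
    · exact ha
    · exact hb
    · simp
  have h1 := hU 1 1 (by simp) (by simp)
  have h2 := hU 1 (-1) (by simp) (by simp)
  have h3 := hU (-1) 1 (by simp) (by simp)
  have h4 := hU (-1) (-1) (by simp) (by simp)
  generalize W - X - Y = R at h1 h2 h3 h4
  simp only [map_add, map_smul, LinearMap.add_apply, LinearMap.smul_apply, hs Y X, hs X R,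
    hs Y R] at h1 h2 h3 h4
  have h5 : (8 : ℂ) • B X Y = 0 := by
    have e : (8 : ℂ) • B X Y = (0 - 0) - (0 - 0) := by
      nth_rw 1 [← h1]
      nth_rw 1 [← h2]
      nth_rw 1 [← h3]
      nth_rw 1 [← h4]
      module
    simpa using e
  simpa using h5

/-- Any two orthonormal rows, here supported on the columns `j` and `l`, are the rows `i` and `k` of
some unitary matrix. -/
theorem apply_combination_eq_zero (hs : ∀ X Y, B X Y = B Y X)
    (h0 : ∀ U ∈ unitaryGroup (Fin d) ℂ, B U U = 0) {i k j l : Fin d} (hik : i ≠ k) (hjl : j ≠ l)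
    {a b c e : ℂ} (h1 : star a * a + star b * b = 1) (h2 : star c * c + star e * e = 1)
    (h3 : star a * c + star b * e = 0) :
    B (a • single i j 1 + b • single i l 1) (c • single k j 1 + e • single k l 1) = 0 := by
  have h3' : star c * a + star e * b = 0 := by
    have := congrArg star h3
    simpa [mul_comm] using this
  have hsum : ∀ a b c e : ℂ, ∑ x, star ((Pi.single j a + Pi.single l b : Fin d → ℂ) x) *
      (Pi.single j c + Pi.single l e : Fin d → ℂ) x = star a * c + star b * e := by
    intro a b c e
    rw [← Finset.sum_subset (Finset.subset_univ {j, l})]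
    · rw [Finset.sum_pair hjl]
      simp [hjl, hjl.symm]
    · intro x _ hx
      simp only [Finset.mem_insert, Finset.mem_singleton, not_or] at hx
      simp [hx.1, hx.2]
  obtain ⟨V, hV, hVx⟩ := exists_unitary_of_orthonormal (s := {i, k})
    (v := fun x => if x = i then (Pi.single j a + Pi.single l b : Fin d → ℂ)
      else Pi.single j c + Pi.single l e) (by
      rintro x (rfl | rfl) y (rfl | rfl)
      · simp only [if_true, hsum, h1]
      · simp only [if_true, if_neg hik, if_neg hik.symm, hsum, h3]
      · simp only [if_true, if_neg hik.symm, hsum, h3']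
      · simp only [if_true, if_neg hik.symm, hsum, h2])
  have hVt : Vᵀ ∈ unitaryGroup (Fin d) ℂ := by
    rw [mem_unitaryGroup_iff]
    have := congrArg transpose (mem_unitaryGroup_iff'.1 hV)
    rw [transpose_mul, transpose_one] at this
    exact this
  have hz := apply_rows_eq_zero hs h0 hik hVt
  have e1 : single i i 1 * Vᵀ = a • single i j 1 + b • single i l 1 := by
    ext x y
    by_cases hx : x = i
    · subst hx
      have := hVx x (by simp) y
      simp [this, Pi.single_apply, single_apply, eq_comm]
    · simp [hx, Ne.symm hx]
  have e2 : single k k 1 * Vᵀ = c • single k j 1 + e • single k l 1 := by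
    ext x y
    by_cases hx : x = k
    · subst hx
      have := hVx x (by simp) y
      simp [this, Pi.single_apply, single_apply, eq_comm, hik]
    · simp [hx, Ne.symm hx]
  rwa [e1, e2] at hz

/-- A symmetric bilinear map whose quadratic map vanishes on the unitary group vanishes on pairs
of matrix units in different rows. -/
theorem apply_single_eq_zero (hs : ∀ X Y, B X Y = B Y X)
    (h0 : ∀ U ∈ unitaryGroup (Fin d) ℂ, B U U = 0) {i k : Fin d} (hik : i ≠ k) (j l : Fin d) :
    B (single i j 1) (single k l 1) = 0 := by
  have hne : ∀ {j l : Fin d}, j ≠ l → B (single i j 1) (single k l 1) = 0 := by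
    intro j l hjl
    simpa using apply_combination_eq_zero hs h0 hik hjl (a := 1) (b := 0) (c := 0) (e := 1)
      (by simp) (by simp) (by simp)
  by_cases hjl : j = l
  swap
  · exact hne hjl
  subst hjl
  obtain ⟨l, hl⟩ : ∃ l, j ≠ l := by
    by_cases h : j = i
    · exact ⟨k, h ▸ hik⟩
    · exact ⟨i, h⟩
  -- The real rotation equates the values at columns `j` and `l`; the same rotation with a phase `i`
  -- on column `l` makes them opposite. The 3-4-5 triple avoids square roots.
  have h1 := apply_combination_eq_zero hs h0 hik hl (a := 3 / 5) (b := 4 / 5) (c := 4 / 5)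
    (e := -3 / 5) (by simp; norm_num) (by simp; norm_num) (by simp; norm_num)
  have h2 := apply_combination_eq_zero hs h0 hik hl (a := 3 / 5) (b := 4 / 5 * Complex.I)
    (c := 4 / 5) (e := -3 / 5 * Complex.I)
    (by simp; linear_combination (-16 / 25) * Complex.I_mul_I)
    (by simp; linear_combination (-9 / 25) * Complex.I_mul_I)
    (by simp; linear_combination (12 / 25) * Complex.I_mul_I)
  simp only [map_add, map_smul, LinearMap.add_apply, LinearMap.smul_apply, hne hl, hne hl.symm,
    smul_zero, add_zero, zero_add, smul_smul] at h1 h2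
  have h3' : (-3 / 5 * Complex.I * (4 / 5 * Complex.I) : ℂ) = 12 / 25 := by
    linear_combination (-12 / 25) * Complex.I_mul_I
  simp only [h3'] at h2
  have h4 : (24 / 25 : ℂ) • B (single i j 1) (single k j 1) = 0 := by
    have e : (24 / 25 : ℂ) • B (single i j 1) (single k j 1) = 0 + 0 := by
      nth_rw 1 [← h1]
      nth_rw 1 [← h2]
      module
    simpa using e
  simpa using h4

/-- For `d ≥ 3`, if `U * K U` is symmetric for all unitary `U`, then `K U = n * Uᵀ` for
a fixed matrix `n`. -/
theorem eq_mul_transpose_of_symmetric (hd : 3 ≤ d)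
    (K : Matrix (Fin d) (Fin d) ℂ →ₗ[ℂ] Matrix (Fin d) (Fin d) ℂ)
    (hK : ∀ U ∈ unitaryGroup (Fin d) ℂ, (U * K U)ᵀ = U * K U) :
    ∃ n : Matrix (Fin d) (Fin d) ℂ, ∀ X, K X = n * Xᵀ := by
  let B : Matrix (Fin d) (Fin d) ℂ →ₗ[ℂ] Matrix (Fin d) (Fin d) ℂ →ₗ[ℂ]
      Matrix (Fin d) (Fin d) ℂ :=
    LinearMap.mk₂ ℂ (fun X Y => (X * K Y + Y * K X) - (X * K Y + Y * K X)ᵀ)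
      (fun X X' Y => by
        simp only [map_add, Matrix.add_mul, Matrix.mul_add, transpose_add]; abel)
      (fun c X Y => by
        simp only [map_smul, smul_mul, Matrix.mul_smul, transpose_add, transpose_smul]; module)
      (fun X Y Y' => by
        simp only [map_add, Matrix.add_mul, Matrix.mul_add, transpose_add]; abel)
      (fun c X Y => by
        simp only [map_smul, smul_mul, Matrix.mul_smul, transpose_add, transpose_smul]; module)
  have hB : ∀ {i k : Fin d}, i ≠ k → ∀ j l p q,
      ((single i j 1 * K (single k l 1) + single k l 1 * K (single i j 1) :
        Matrix (Fin d) (Fin d) ℂ)) p q =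
      ((single i j 1 * K (single k l 1) + single k l 1 * K (single i j 1) :
        Matrix (Fin d) (Fin d) ℂ)) q p := by
    intro i k hik j l p q
    have := apply_single_eq_zero (B := B) (fun X Y => by
      simp only [B, LinearMap.mk₂_apply, add_comm]) (fun U hU => by
      simp only [B, LinearMap.mk₂_apply, transpose_add, hK U hU, sub_self]) hik j l
    have h2 := congrFun (congrFun this p) q
    simp only [B, LinearMap.mk₂_apply, Matrix.sub_apply, transpose_apply, Matrix.zero_apply] at h2
    exact sub_eq_zero.1 h2
  -- This is where `d ≥ 3` enters: an auxiliary row `k` isolates single entries of `K` in the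
  -- symmetric matrix `E_ij K(E_kl) + E_kl K(E_ij)`.
  have third : ∀ i p : Fin d, ∃ k, k ≠ i ∧ k ≠ p := by
    intro i p
    obtain ⟨k, hk⟩ := Finset.exists_mem_notMem_of_card_lt_card (s := {i, p})
      (t := (Finset.univ : Finset (Fin d)))
      (lt_of_le_of_lt Finset.card_le_two (by simpa using (by omega : 2 < d)))
    simp only [Finset.mem_insert, Finset.mem_singleton, not_or] at hk
    exact ⟨k, hk.2⟩
  have hoff : ∀ i j l p, p ≠ i → K (single i j 1) l p = 0 := by
    intro i j l p hp
    obtain ⟨k, hki, hkp⟩ := third i p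
    have := hB (Ne.symm hki) j l k p
    simpa [Ne.symm hki, hki, hp, hp.symm, hkp, Ne.symm hkp] using this
  have hswap : ∀ i k j l, i ≠ k → K (single k l 1) j k = K (single i j 1) l i := by
    intro i k j l hik
    have := hB hik j l i k
    simpa [hik, hik.symm] using this
  let i₀ : Fin d := ⟨0, by omega⟩
  have hconst : ∀ i j l, K (single i j 1) l i = K (single i₀ j 1) l i₀ := by
    intro i j l
    obtain ⟨k, hki, hk0⟩ := third i i₀
    rw [← hswap i k j l hki.symm, ← hswap i₀ k j l hk0.symm]
  refine ⟨of fun l j => K (single i₀ j 1) l i₀, fun X => ?_⟩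
  ext l p
  conv_lhs => rw [matrix_eq_sum_single X]
  simp only [map_sum, Matrix.sum_apply]
  rw [Finset.sum_eq_single p]
  · rw [mul_apply]
    refine Finset.sum_congr rfl fun j _ => ?_
    have : single p j (X p j) = X p j • single p j (1 : ℂ) := by simp
    rw [this, map_smul, Matrix.smul_apply, hconst, of_apply, transpose_apply, smul_eq_mul,
      mul_comm]
  · intro i _ hi
    refine Finset.sum_eq_zero fun j _ => ?_
    have : single i j (X i j) = X i j • single i j (1 : ℂ) := by simp
    rw [this, map_smul, Matrix.smul_apply, hoff i j l p hi.symm, smul_zero]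
  · simp

end Polarization

/-! ### The bound `d + 3` for transposition -/

section TranspositionMain

variable {d m N : ℕ}

/-- With a single query the circuit is linear in the query matrix, which makes polarization
available. -/
theorem krausOp_one_add {κ n : Type} [Fintype n] [DecidableEq n] [Fintype κ] [DecidableEq κ]
    (W : ℕ → Matrix (n × κ) (n × κ) ℂ) (a : κ → ℂ) (X Y : Matrix n n ℂ) (j : κ) :
    krausOp W a (X + Y) 1 j = krausOp W a X 1 j + krausOp W a Y 1 j := by
  ext p i
  simp only [krausOp, seqCircuit, add_kronecker, Matrix.mul_add, of_apply,
    Matrix.add_apply, add_mul, Finset.sum_add_distrib]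

theorem krausOp_one_smul {κ n : Type} [Fintype n] [DecidableEq n] [Fintype κ] [DecidableEq κ]
    (W : ℕ → Matrix (n × κ) (n × κ) ℂ) (a : κ → ℂ) (c : ℂ) (X : Matrix n n ℂ) (j : κ) :
    krausOp W a (c • X) 1 j = c • krausOp W a X 1 j := by
  ext p i
  simp only [krausOp, seqCircuit, smul_kronecker, Matrix.mul_smul, smul_mul, of_apply,
    Matrix.smul_apply, smul_eq_mul, mul_assoc, Finset.mul_sum]

/-- Transposition is not completely positive. -/
theorem not_kraus_transpose (hd : 2 ≤ d) (K : Fin m → Matrix (Fin d) (Fin d) ℂ) :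
    ¬ ∀ X, ∑ j, (K j)ᴴ * X * K j = Xᵀ := by
  intro h
  have he : ∀ p q i i', ∑ j, star (K j p i) * K j q i' =
      (single q p 1 : Matrix (Fin d) (Fin d) ℂ) i i' := by
    intro p q i i'
    have := congrFun (congrFun (h (single p q 1)) i) i'
    simpa only [Matrix.sum_apply, conjTranspose_mul_single_mul_apply, transpose_single]
      using this
  let x : Fin d := ⟨0, by omega⟩
  let y : Fin d := ⟨1, by omega⟩
  have hxy : x ≠ y := by simp [x, y]
  -- A zero diagonal entry of a positive Choi matrix kills its row, yet the transposition has an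
  -- entry 1 there.
  have h1 := he x x y y
  rw [single_apply_of_ne _ _ _ _ _ (by simp [hxy])] at h1
  have h2 : ∀ j, K j x y = 0 := by
    intro j
    have h3 := (Finset.sum_eq_zero_iff_of_nonneg fun _ _ => star_mul_self_nonneg _).1 h1 j
      (Finset.mem_univ _)
    rcases mul_eq_zero.1 h3 with h4 | h4
    · exact star_eq_zero.1 h4
    · exact h4
  have h5 := he x y y x
  simp [h2] at h5

theorem transposition_lower_bound (hd : 2 ≤ d) (h : Implementable (transposition d) N) :
    d + 2 ≤ N := by
  obtain ⟨m, a, W, ha, hW, hf⟩ := h.exists_pure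
  exact (transposition_lower_bound_aux hd ha hW hf).1

theorem transposition_lower_bound_of_three_le (hd : 3 ≤ d)
    (h : Implementable (transposition d) N) : d + 3 ≤ N := by
  obtain ⟨m, a, W, ha, hW, hf⟩ := h.exists_pure
  obtain ⟨h1, h2⟩ := transposition_lower_bound_aux (by omega) ha hW hf
  by_contra hcon
  have hsym := h2 (by omega)
  let K : Fin m → Matrix (Fin d) (Fin d) ℂ →ₗ[ℂ] Matrix (Fin d) (Fin d) ℂ := fun j =>
    { toFun := fun X => krausOp W a X 1 j
      map_add' := fun X Y => krausOp_one_add W a X Y j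
      map_smul' := fun c X => krausOp_one_smul W a c X j }
  have hK : ∀ j, ∀ U ∈ unitaryGroup (Fin d) ℂ, (U * K j U)ᵀ = U * K j U := by
    intro j U hU
    -- `U * K j U` is quadratic in `U`, so the phase only contributes the nonzero factor `z * z`.
    obtain ⟨z, hz, hzU⟩ := exists_smul_mem_specialUnitaryGroup (by omega) hU
    have hs : ((z • U) * K j (z • U))ᵀ = (z • U) * K j (z • U) := hsym ⟨z • U, hzU⟩ j
    have hz0 : z * z ≠ 0 := by
      intro h0
      rcases mul_self_eq_zero.1 h0 with rfl
      simp at hz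
    simp only [map_smul, smul_mul, Matrix.mul_smul, transpose_smul, smul_smul] at hs
    exact smul_right_injective _ hz0 hs
  choose n hn using fun j => eq_mul_transpose_of_symmetric hd (K j) (hK j)
  -- The gate after the first query cancels, leaving the completely positive map before that query.
  -- With `K j X = n j * Xᵀ` the left side becomes `Xᵀ`.
  have hstep : ∀ X : Matrix (Fin d) (Fin d) ℂ, ∑ j, (K j 1)ᴴ * K j X =
      ∑ j, (krausOp W a 1 0 j)ᴴ * X * krausOp W a 1 0 j := by
    intro X
    have h3 := sum_krausOp_conjTranspose_mul_mul W a 1 X 1 1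
    simp only [Matrix.mul_one, one_kronecker_one] at h3
    rw [sum_krausOp_conjTranspose_mul_mul]
    refine h3.trans ?_
    congr 2
    calc (seqCircuit W 1 1)ᴴ * seqCircuit W X 1
        = (W 0)ᴴ * ((W 1)ᴴ * W 1) * (X ⊗ₖ 1) * W 0 := by
          simp only [seqCircuit, one_kronecker_one, Matrix.mul_one, conjTranspose_mul,
            Matrix.mul_assoc]
      _ = _ := by rw [hW, Matrix.mul_one]; rfl
  have hn1 : ∑ j, (n j)ᴴ * n j = 1 := by
    have h4 := hstep 1
    simp only [hn, transpose_one, Matrix.mul_one] at h4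
    rw [h4]
    exact sum_krausOp_conjTranspose_mul_self hW ha (by simp) 0
  refine not_kraus_transpose (by omega) (fun j => krausOp W a 1 0 j) fun X => ?_
  rw [← hstep X]
  simp only [hn, transpose_one, Matrix.mul_one]
  simp only [← Matrix.mul_assoc]
  rw [← Matrix.sum_mul, hn1, Matrix.one_mul]

end TranspositionMain

/-! ### Invariance of the Levi-Civita symbol -/

section LeviCivita

variable {d n : ℕ}

/-- The Levi-Civita symbol. -/
def leviCivita (v : Fin d → Fin d) : ℤ := ((1 : Matrix (Fin d) (Fin d) ℤ).submatrix v id).det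

theorem leviCivita_id : leviCivita (id : Fin d → Fin d) = 1 := by
  simp [leviCivita]

theorem injective_of_leviCivita_ne_zero {v : Fin d → Fin d} (h : leviCivita v ≠ 0) :
    Function.Injective v := by
  intro i j hij
  by_contra hne
  exact h (det_zero_of_row_eq hne (by
    funext x
    change (1 : Matrix (Fin d) (Fin d) ℤ) (v i) x = (1 : Matrix (Fin d) (Fin d) ℤ) (v j) x
    rw [hij]))

theorem leviCivita_perm_comp_sq (π : Equiv.Perm (Fin d)) (v : Fin d → Fin d) :
    leviCivita (π ∘ v) ^ 2 = leviCivita v ^ 2 := by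
  have h : (1 : Matrix (Fin d) (Fin d) ℤ).submatrix (π ∘ v) id =
      ((1 : Matrix (Fin d) (Fin d) ℤ).submatrix v id).submatrix id π.symm := by
    ext i j
    simp [one_apply, Equiv.eq_symm_apply]
  rw [leviCivita, h, det_permute', mul_pow, ← Int.cast_pow, ← Units.val_pow_eq_pow_val,
    Int.units_sq]
  simp [leviCivita]

/-- Expand the determinant of the rows `v k` of `U` multilinearly in the standard basis. -/
theorem sum_prod_mul_leviCivita (U : Matrix (Fin d) (Fin d) ℂ) (v : Fin d → Fin d) :
    ∑ w : Fin d → Fin d, (∏ k, U (v k) (w k)) * (leviCivita w : ℂ) = leviCivita v * U.det := by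
  have hcast : ∀ w : Fin d → Fin d,
      (leviCivita w : ℂ) = ((1 : Matrix (Fin d) (Fin d) ℂ).submatrix w id).det := by
    intro w
    have := (Int.castRingHom ℂ).map_det ((1 : Matrix (Fin d) (Fin d) ℤ).submatrix w id)
    rw [leviCivita]
    refine this.trans (congrArg det ?_)
    ext i j
    simp [one_apply, apply_ite]
  simp only [hcast]
  rw [← det_mul]
  have h1 : (1 : Matrix (Fin d) (Fin d) ℂ).submatrix v id * U =
      fun k => ∑ x, U (v k) x • (1 : Matrix (Fin d) (Fin d) ℂ) x := by
    ext k l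
    simp [mul_apply, one_apply, Finset.sum_apply]
  rw [h1]
  have h2 := (detRowAlternating (R := ℂ) (n := Fin d)).toMultilinearMap.map_sum
    (fun k x => U (v k) x • (1 : Matrix (Fin d) (Fin d) ℂ) x)
  refine Eq.trans ?_ h2.symm
  refine Finset.sum_congr rfl fun w _ => ?_
  have h3 := (detRowAlternating (R := ℂ) (n := Fin d)).toMultilinearMap.map_smul_univ
    (fun k => U (v k) (w k)) (fun k => (1 : Matrix (Fin d) (Fin d) ℂ) (w k))
  exact h3.symm

theorem sum_leviCivita_cons (U : Matrix (Fin (n + 1)) (Fin (n + 1)) ℂ) (hU : U.det = 1)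
    (j : Fin (n + 1)) (x : Fin n → Fin (n + 1)) :
    ∑ i, ∑ y : Fin n → Fin (n + 1), U j i * (∏ k, U (x k) (y k)) *
      (leviCivita (Fin.cons i y : Fin (n + 1) → Fin (n + 1)) : ℂ) =
      leviCivita (Fin.cons j x : Fin (n + 1) → Fin (n + 1)) := by
  have h := sum_prod_mul_leviCivita U (Fin.cons j x)
  rw [hU, mul_one, ← (Fin.consEquiv fun _ => Fin (n + 1)).sum_comp, Fintype.sum_prod_type] at h
  rw [← h]
  refine Finset.sum_congr rfl fun i _ => Finset.sum_congr rfl fun y _ => ?_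
  simp [Fin.prod_univ_succ, Fin.consEquiv]

/-- Relabelling by the transposition of `0` and `i` changes the symbol only by a sign. Hence one
normalisation serves all codewords. -/
theorem sum_leviCivita_cons_sq (i : Fin (n + 1)) :
    ∑ x : Fin n → Fin (n + 1), leviCivita (Fin.cons i x : Fin (n + 1) → Fin (n + 1)) ^ 2 =
      ∑ x : Fin n → Fin (n + 1), leviCivita (Fin.cons 0 x : Fin (n + 1) → Fin (n + 1)) ^ 2 := by
  rw [← (Equiv.arrowCongr (Equiv.refl (Fin n)) (Equiv.swap 0 i)).sum_comp]
  refine Finset.sum_congr rfl fun x _ => ?_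
  rw [← leviCivita_perm_comp_sq (Equiv.swap 0 i)]
  congr 2
  funext k
  refine Fin.cases ?_ (fun k => ?_) k
  · simp
  · simp

theorem sum_leviCivita_cons_zero_sq_pos :
    0 < ∑ x : Fin n → Fin (n + 1),
      leviCivita (Fin.cons 0 x : Fin (n + 1) → Fin (n + 1)) ^ 2 := by
  refine Finset.sum_pos' (fun _ _ => sq_nonneg _) ⟨Fin.succ, Finset.mem_univ _, ?_⟩
  have : (Fin.cons 0 Fin.succ : Fin (n + 1) → Fin (n + 1)) = id := by
    funext k
    refine Fin.cases ?_ (fun k => ?_) k <;> simp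
  rw [this, leviCivita_id]
  norm_num

/-- If the first factor is nonzero, `j` already occurs in `x`, so the second sequence repeats it.
This is the orthogonality of distinct codewords. -/
theorem leviCivita_cons_mul_leviCivita_cons {i j : Fin (n + 1)} (hij : i ≠ j)
    (x : Fin n → Fin (n + 1)) :
    leviCivita (Fin.cons i x : Fin (n + 1) → Fin (n + 1)) *
      leviCivita (Fin.cons j x : Fin (n + 1) → Fin (n + 1)) = 0 := by
  by_contra h
  have h1 := injective_of_leviCivita_ne_zero (left_ne_zero_of_mul h)
  have h2 := injective_of_leviCivita_ne_zero (right_ne_zero_of_mul h)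
  obtain ⟨k, hk⟩ := Finite.surjective_of_injective h1 j
  revert hk
  refine Fin.cases (fun hk => ?_) (fun k hk => ?_) k
  · exact hij (by simpa using hk)
  · have : (Fin.cons j x : Fin (n + 1) → Fin (n + 1)) k.succ =
        (Fin.cons j x : Fin (n + 1) → Fin (n + 1)) 0 := by simpa using hk
    exact Fin.succ_ne_zero k (h2 this)

end LeviCivita

/-! ### Building circuits -/

section Circuits

variable {d m : ℕ}

/-- `F` is the operator of some circuit with `N` queries. -/
def IsCircuit (N : ℕ) (F : SU d → Matrix (Fin d × Fin m) (Fin d × Fin m) ℂ) : Prop :=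
  ∃ V : Fin (N + 1) → unitaryGroup (Fin d × Fin m) ℂ, ∀ U, circuit N V U = F U

theorem IsCircuit.zero (W : unitaryGroup (Fin d × Fin m) ℂ) :
    IsCircuit 0 (fun _ : SU d => (W : Matrix (Fin d × Fin m) (Fin d × Fin m) ℂ)) :=
  ⟨fun _ => W, fun _ => rfl⟩

theorem IsCircuit.query {N : ℕ} {F : SU d → Matrix (Fin d × Fin m) (Fin d × Fin m) ℂ}
    (hF : IsCircuit N F) (W : unitaryGroup (Fin d × Fin m) ℂ) :
    IsCircuit (N + 1) fun U => (W : Matrix (Fin d × Fin m) (Fin d × Fin m) ℂ) *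
      ((U : Matrix (Fin d) (Fin d) ℂ) ⊗ₖ (1 : Matrix (Fin m) (Fin m) ℂ)) * F U := by
  obtain ⟨V, hV⟩ := hF
  refine ⟨Fin.snoc V W, fun U => ?_⟩
  simp only [circuit, Fin.snoc_last, Fin.snoc_castSucc, hV]

theorem IsCircuit.gate {N : ℕ} {F : SU d → Matrix (Fin d × Fin m) (Fin d × Fin m) ℂ}
    (hF : IsCircuit N F) (W : unitaryGroup (Fin d × Fin m) ℂ) :
    IsCircuit N fun U => (W : Matrix (Fin d × Fin m) (Fin d × Fin m) ℂ) * F U := by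
  obtain ⟨V, hV⟩ := hF
  cases N with
  | zero => exact ⟨fun _ => W * V 0, fun U => by beta_reduce; rw [← hV]; rfl⟩
  | succ N =>
    refine ⟨Fin.snoc (fun k => V k.castSucc) (W * V (Fin.last (N + 1))), fun U => ?_⟩
    beta_reduce
    rw [← hV]
    simp only [circuit, Fin.snoc_last, Fin.snoc_castSucc, Submonoid.coe_mul, Matrix.mul_assoc]

theorem submatrix_one_mem_unitaryGroup {ι : Type} [Fintype ι] [DecidableEq ι]
    (σ : Equiv.Perm ι) : (1 : Matrix ι ι ℂ).submatrix σ id ∈ unitaryGroup ι ℂ := by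
  rw [mem_unitaryGroup_iff, star_eq_conjTranspose, conjTranspose_submatrix, conjTranspose_one]
  have := submatrix_mul_equiv (1 : Matrix ι ι ℂ) (1 : Matrix ι ι ℂ) σ (Equiv.refl ι) σ
  simpa using this

end Circuits

/-! ### Parallel queries on registers -/

section Registers

variable {d n m : ℕ}

/-- The product operator `⊗ M l` on `n` registers of dimension `d`, which are encoded by `e`. -/
def registerOp (e : (Fin n → Fin d) ≃ Fin m) (M : Fin n → Matrix (Fin d) (Fin d) ℂ) :
    Matrix (Fin m) (Fin m) ℂ :=
  of fun r s => ∏ l, M l (e.symm r l) (e.symm s l)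

theorem registerOp_mul (e : (Fin n → Fin d) ≃ Fin m) (M M' : Fin n → Matrix (Fin d) (Fin d) ℂ) :
    registerOp e M * registerOp e M' = registerOp e fun l => M l * M' l := by
  ext r s
  simp only [registerOp, mul_apply, of_apply]
  rw [← e.sum_comp]
  simp only [Equiv.symm_apply_apply, ← Finset.prod_mul_distrib]
  rw [Finset.prod_univ_sum, Fintype.piFinset_univ]

theorem registerOp_one (e : (Fin n → Fin d) ≃ Fin m) : registerOp e (fun _ => 1) = 1 := by
  ext r s
  simp only [registerOp, of_apply, one_apply]
  by_cases h : r = s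
  · subst h
    simp
  · obtain ⟨l, hl⟩ := Function.ne_iff.1 (e.symm.injective.ne h)
    rw [if_neg h]
    exact Finset.prod_eq_zero (Finset.mem_univ l) (if_neg hl)

/-- The exchange of the main system with the register `k`. -/
def swapRegister (e : (Fin n → Fin d) ≃ Fin m) (k : Fin n) : Equiv.Perm (Fin d × Fin m) :=
  Function.Involutive.toPerm
    (fun x => (e.symm x.2 k, e (Function.update (e.symm x.2) k x.1))) (by
      rintro ⟨p, r⟩
      simp)

theorem query_register (e : (Fin n → Fin d) ≃ Fin m) (k : Fin n) (U : Matrix (Fin d) (Fin d) ℂ) :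
    (1 : Matrix (Fin d × Fin m) (Fin d × Fin m) ℂ).submatrix (swapRegister e k) id *
      (U ⊗ₖ (1 : Matrix (Fin m) (Fin m) ℂ)) *
        (1 : Matrix (Fin d × Fin m) (Fin d × Fin m) ℂ).submatrix (swapRegister e k) id =
      (1 : Matrix (Fin d) (Fin d) ℂ) ⊗ₖ registerOp e (Function.update (fun _ => 1) k U) := by
  have hsymm : ∀ x, (swapRegister e k).symm x = swapRegister e k x := fun x => rfl
  have h1 : ∀ A : Matrix (Fin d × Fin m) (Fin d × Fin m) ℂ,
      (1 : Matrix (Fin d × Fin m) (Fin d × Fin m) ℂ).submatrix (swapRegister e k) id * A *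
        (1 : Matrix (Fin d × Fin m) (Fin d × Fin m) ℂ).submatrix (swapRegister e k) id =
      A.submatrix (swapRegister e k) (swapRegister e k) := by
    intro A
    have e1 : (1 : Matrix (Fin d × Fin m) (Fin d × Fin m) ℂ).submatrix (swapRegister e k) id * A =
        A.submatrix (swapRegister e k) id := by
      ext x y
      simp [mul_apply, one_apply]
    rw [e1]
    ext x y
    have : ∀ z, (swapRegister e k z = y) ↔ (z = swapRegister e k y) := by
      intro z
      rw [← hsymm y, Equiv.eq_symm_apply]
    simp [mul_apply, one_apply, this]
  have hswap : ∀ p r, swapRegister e k (p, r) =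
    (e.symm r k, e (Function.update (e.symm r) k p)) := fun _ _ => rfl
  rw [h1]
  ext ⟨p, r⟩ ⟨q, s⟩
  simp only [submatrix_apply, hswap, kroneckerMap_apply, registerOp, of_apply, one_apply, e.injective.eq_iff]
  set x := e.symm r
  set y := e.symm s
  by_cases h : Function.update x k p = Function.update y k q
  · have hpq : p = q := by simpa using congrFun h k
    have hxy : ∀ l, l ≠ k → x l = y l := fun l hl => by simpa [hl] using congrFun h l
    rw [if_pos h, if_pos hpq, Finset.prod_eq_single k]
    · simp
    · intro l _ hl
      simp [hl, hxy l hl]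
    · simp
  · rw [if_neg h, mul_zero]
    by_cases hpq : p = q
    · subst hpq
      obtain ⟨l, hl⟩ := Function.ne_iff.1 h
      have hlk : l ≠ k := by
        rintro rfl
        simp at hl
      rw [Finset.prod_eq_zero (Finset.mem_univ l), mul_zero]
      simpa [hlk, one_apply] using hl
    · simp [hpq]

/-- Each query is moved to a fresh register by swapping that register with the main system before
and after it. -/
theorem isCircuit_registerOp (e : (Fin n → Fin d) ≃ Fin m) (V : unitaryGroup (Fin d × Fin m) ℂ)
    {k : ℕ} (hk : k ≤ n) :
    IsCircuit k fun U : SU d => ((1 : Matrix (Fin d) (Fin d) ℂ) ⊗ₖ registerOp e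
      fun l => if l.1 < k then (U : Matrix (Fin d) (Fin d) ℂ) else 1) *
        (V : Matrix (Fin d × Fin m) (Fin d × Fin m) ℂ) := by
  induction k with
  | zero => simpa [registerOp_one] using IsCircuit.zero V
  | succ k ih =>
    let S : unitaryGroup (Fin d × Fin m) ℂ := ⟨_, submatrix_one_mem_unitaryGroup
      (swapRegister e ⟨k, hk⟩)⟩
    have h := (((ih (by omega)).gate S).query S)
    convert h using 2 with U
    rw [← Matrix.mul_assoc, ← Matrix.mul_assoc, query_register, ← mul_kronecker_mul,
      registerOp_mul, Matrix.mul_one]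
    congr 3
    funext l
    by_cases hl : l = ⟨k, hk⟩
    · subst hl; simp
    · have : l.1 ≠ k := fun h => hl (Fin.ext h)
      have h2 : l.1 < k + 1 ↔ l.1 < k := by omega
      simp [hl, h2]

end Registers

/-! ### The optimal circuit for conjugation -/

section Conjugation

theorem kronecker_single_eq {d m : ℕ} (ρ : Matrix (Fin d) (Fin d) ℂ) (q : Fin m) :
    ρ ⊗ₖ single q q (1 : ℂ) = tensorRight (Fin d) (Pi.single q (1 : ℂ)) * ρ *
      (tensorRight (Fin d) (Pi.single q (1 : ℂ)))ᴴ := by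
  ext ⟨p, r⟩ ⟨p', r'⟩
  simp only [tensorRight, mul_apply, conjTranspose_apply, of_apply, kroneckerMap_apply]
  rw [Finset.sum_eq_single p', Finset.sum_eq_single p]
  · by_cases h : r = q <;> by_cases h' : r' = q <;>
      simp [h, h', eq_comm (a := q)]
  · intro b _ hb
    simp [hb.symm]
  · simp
  · intro b _ hb
    simp [hb.symm]
  · simp

theorem partialTrace_kronecker_single {d m : ℕ} (ρ : Matrix (Fin d) (Fin d) ℂ) (q : Fin m) :
    partialTrace (ρ ⊗ₖ single q q (1 : ℂ)) = ρ := by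
  ext p p'
  simp [partialTrace, single_apply]

theorem conjugation_implementable (n : ℕ) : Implementable (conjugation (n + 1)) n := by
  let e : (Fin n → Fin (n + 1)) ≃ Fin (Fintype.card (Fin n → Fin (n + 1))) := Fintype.equivFin _
  let q : Fin (Fintype.card (Fin n → Fin (n + 1))) := e 0
  let c : ℤ := ∑ x : Fin n → Fin (n + 1),
    leviCivita (Fin.cons 0 x : Fin (n + 1) → Fin (n + 1)) ^ 2
  have hc : 0 < c := sum_leviCivita_cons_zero_sq_pos
  let s : ℂ := ((Real.sqrt c)⁻¹ : ℝ)
  have hs : star s * s * (c : ℂ) = 1 := by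
    have h1 : star s = s := Complex.conj_ofReal _
    have hc' : (0 : ℝ) < c := by exact_mod_cast hc
    have h2 : s * s = ((c : ℝ)⁻¹ : ℝ) := by
      simp only [s]
      rw [← Complex.ofReal_mul, ← mul_inv, Real.mul_self_sqrt hc'.le]
    rw [h1, h2]
    push_cast
    exact inv_mul_cancel₀ (by exact_mod_cast hc.ne')
  -- The codeword of `i` is the normalised antisymmetric state of the `n` registers that omits `i`,
  -- with the main system reset to `0`.
  let enc : Fin (n + 1) → Fin (n + 1) × Fin (Fintype.card (Fin n → Fin (n + 1))) → ℂ :=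
    fun i x => if x.1 = 0 then
      s * (leviCivita (Fin.cons i (e.symm x.2) : Fin (n + 1) → Fin (n + 1)) : ℂ) else 0
  have henc : ∀ i j, ∑ x, star (enc i x) * enc j x = if i = j then 1 else 0 := by
    intro i j
    rw [Fintype.sum_prod_type, Finset.sum_eq_single 0]
    · simp only [enc, if_true]
      rw [← e.sum_comp]
      simp only [Equiv.symm_apply_apply]
      have h1 : ∀ x : Fin n → Fin (n + 1),
          star (s * (leviCivita (Fin.cons i x : Fin (n + 1) → Fin (n + 1)) : ℂ)) *
            (s * (leviCivita (Fin.cons j x : Fin (n + 1) → Fin (n + 1)) : ℂ)) =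
          star s * s * ((leviCivita (Fin.cons i x : Fin (n + 1) → Fin (n + 1)) *
            leviCivita (Fin.cons j x : Fin (n + 1) → Fin (n + 1)) : ℤ) : ℂ) := by
        intro x
        have : star ((leviCivita (Fin.cons i x : Fin (n + 1) → Fin (n + 1)) : ℤ) : ℂ) =
          ((leviCivita (Fin.cons i x : Fin (n + 1) → Fin (n + 1)) : ℤ) : ℂ) := by simp
        rw [star_mul', this]
        push_cast
        ring
      simp only [h1, ← Finset.mul_sum, ← Int.cast_sum]
      by_cases hij : i = j
      · subst hij
        simp only [← pow_two, if_true]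
        rw [sum_leviCivita_cons_sq]
        exact hs
      · simp [leviCivita_cons_mul_leviCivita_cons hij, hij]
    · intro b _ hb
      simp [enc, hb]
    · simp
  obtain ⟨V, hV, hVx⟩ := exists_unitary_of_orthonormal
    (s := {x : Fin (n + 1) × Fin (Fintype.card (Fin n → Fin (n + 1))) | x.2 = q})
    (v := fun x => enc x.1) (by
      rintro ⟨i, r⟩ hr ⟨j, r'⟩ hr'
      change r = q at hr
      change r' = q at hr'
      subst hr hr'
      simp only [henc, Prod.mk.injEq, and_true])
  let J := tensorRight (Fin (n + 1)) (Pi.single q (1 : ℂ))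
  have hVJ : V * J = of fun x i => enc i x := by
    ext x i
    have := hVx (i, q) rfl x
    rw [of_apply, ← this]
    simp [J, tensorRight, mul_apply, Fintype.sum_prod_type, Pi.single_apply]
  obtain ⟨W, hW⟩ := (isCircuit_registerOp e ⟨V, hV⟩ le_rfl).gate (⟨V, hV⟩⁻¹)
  refine ⟨_, single q q 1, W, ⟨?_, by simp⟩, fun U ρ _ => ?_⟩
  · have : single q q (1 : ℂ) = vecMulVec (Pi.single q 1) (star (Pi.single q 1)) := by
      ext i j
      by_cases h : q = i <;> by_cases h' : q = j <;>
      simp [vecMulVec_apply, single_apply, Pi.single_apply, h, h', eq_comm]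
    rw [this]
    exact posSemidef_vecMulVec_self_star _
  · have hU : (conjugation (n + 1) U : Matrix (Fin (n + 1)) (Fin (n + 1)) ℂ) =
      (U : Matrix (Fin (n + 1)) (Fin (n + 1)) ℂ)ᴴᵀ := rfl
    set u : Matrix (Fin (n + 1)) (Fin (n + 1)) ℂ := U.1 with hu
    have huu : uᵀ * uᴴᵀ = 1 := by
      rw [← transpose_mul, SU.conjTranspose_mul_self, transpose_one]
    -- Applying `u` to all `n + 1` indices of the Levi-Civita tensor multiplies it by `det u = 1`.
    -- Moving the factor `uᵀ` on the input across turns `u` on the `n` registers into `u^*` on the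
    -- encoded system.
    have henc_u : ((1 : Matrix (Fin (n + 1)) (Fin (n + 1)) ℂ) ⊗ₖ registerOp e fun _ => u) *
        (V * J) * uᵀ = V * J := by
      rw [hVJ]
      ext ⟨p, r⟩ j
      have h1 := sum_leviCivita_cons u U.2.2 j (e.symm r)
      simp only [mul_apply, of_apply, kroneckerMap_apply, Fintype.sum_prod_type, transpose_apply]
      by_cases hp : p = 0
      · subst hp
        simp only [enc, if_true]
        rw [← h1, Finset.mul_sum]
        refine Finset.sum_congr rfl fun i _ => ?_
        rw [Finset.sum_eq_single 0]
        · rw [← e.sum_comp]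
          simp only [if_true, Equiv.symm_apply_apply, registerOp, of_apply, one_apply_eq,
            Finset.mul_sum, Finset.sum_mul]
          exact Finset.sum_congr rfl fun y _ => by ring
        · intro b _ hb
          simp [hb]
        · simp
      · simp only [enc, if_neg hp]
        refine Finset.sum_eq_zero fun i _ => ?_
        rw [Finset.sum_eq_zero, zero_mul]
        intro b _
        refine Finset.sum_eq_zero fun r' _ => ?_
        by_cases hb : b = 0
        · subst hb; simp [hp]
        · simp [hb]
    have hVV : Vᴴ * V = 1 := mem_unitaryGroup_iff'.1 hV
    have hZ : circuit n W U * J = J * uᴴᵀ := by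
      rw [hW]
      simp only [Fin.is_lt, if_true]
      have h2 : ((1 : Matrix (Fin (n + 1)) (Fin (n + 1)) ℂ) ⊗ₖ registerOp e fun _ => u) *
          (V * J) = V * J * uᴴᵀ := by
        calc _ = ((1 : Matrix (Fin (n + 1)) (Fin (n + 1)) ℂ) ⊗ₖ registerOp e fun _ => u) *
            (V * J) * (uᵀ * uᴴᵀ) := by rw [huu, Matrix.mul_one]
          _ = _ := by rw [← Matrix.mul_assoc, henc_u]
      calc _ = Vᴴ * (((1 : Matrix (Fin (n + 1)) (Fin (n + 1)) ℂ) ⊗ₖ registerOp e fun _ => u) *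
            (V * J)) := by simp only [Matrix.mul_assoc]; rfl
        _ = Vᴴ * V * (J * uᴴᵀ) := by rw [h2]; simp only [Matrix.mul_assoc]
        _ = _ := by rw [hVV, Matrix.one_mul]
    have h3 : circuit n W U * (ρ ⊗ₖ single q q 1) * (circuit n W U)ᴴ =
        (uᴴᵀ * ρ * uᴴᵀᴴ) ⊗ₖ single q q 1 := by
      rw [kronecker_single_eq, kronecker_single_eq]
      calc _ = (circuit n W U * J) * ρ * (circuit n W U * J)ᴴ := by
            simp only [conjTranspose_mul, Matrix.mul_assoc]; rfl
        _ = _ := by rw [hZ]; simp only [conjTranspose_mul, Matrix.mul_assoc]; rfl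
    rw [h3, partialTrace_kronecker_single, hU]

end Conjugation

end UnitaryQuery

theorem corollary2 (d : ℕ) (hd : 1 ≤ d) :
    (2 ≤ d → ((d ^ 2 : ℕ) : ℕ∞) ≤ UnitaryQuery.queryComplexity (UnitaryQuery.inversion d)) ∧
    (d = 2 → (4 : ℕ∞) ≤ UnitaryQuery.queryComplexity (UnitaryQuery.transposition d)) ∧
    (3 ≤ d → ((d + 3 : ℕ) : ℕ∞) ≤
      UnitaryQuery.queryComplexity (UnitaryQuery.transposition d)) ∧
    UnitaryQuery.queryComplexity (UnitaryQuery.conjugation d) = ((d - 1 : ℕ) : ℕ∞) := by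
  refine ⟨fun h2 => ?_, fun h2 => ?_, fun h3 => ?_, le_antisymm ?_ ?_⟩
  · exact le_iInf₂ fun N hN => Nat.cast_le.2 (UnitaryQuery.inversion_lower_bound h2 hN)
  · subst h2
    exact le_iInf₂ fun N hN =>
      Nat.cast_le.2 (UnitaryQuery.transposition_lower_bound le_rfl hN)
  · exact le_iInf₂ fun N hN =>
      Nat.cast_le.2 (UnitaryQuery.transposition_lower_bound_of_three_le h3 hN)
  · obtain ⟨n, rfl⟩ : ∃ n, d = n + 1 := ⟨d - 1, by omega⟩
    exact iInf₂_le n (UnitaryQuery.conjugation_implementable n)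
  · exact le_iInf₂ fun N hN => Nat.cast_le.2 (UnitaryQuery.conjugation_lower_bound hd hN)
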